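/- Let $\Gamma$ and $G$ be finite connected graphs (compact connected 1-dimensional CW complexes), where $G$ is not homeomorphic to an interval, and let $\tau\colon\Gamma\to\Gamma$ be a fixed-point free continuous involution. Let $\operatorname{Conf}_2(G)=\{(x,y)\in G^2 : x\neq y\}$, let $\operatorname{UConf}_2(G)$ be its orbit space under $(x,y)\mapsto(y,x)$, and fix base points $x_0\in\Gamma$ and $(g_0,g_1)\in\operatorname{Conf}_2(G)$; the spaces $G$, $\Gamma/\tau$ and $\operatorname{UConf}_2(G)$ are based at $g_0$, $[x_0]$ and $\{g_0,g_1\}$. Put $P_2(G)=\pi_1(\operatorname{Conf}_2(G))$ and $B_2(G)=\pi_1(\operatorname{UConf}_2(G))$, and let $p_1\colon\operatorname{Conf}_2(G)\to G$ be the first projection. Let $\iota_1\colon\pi_1(\Gamma)\to\pi_1(\Gamma/\tau)$ and $\iota_2\colon P_2(G)\to B_2(G)$ be induced by the 2-fold covering projections, and let $\theta_1\colon\pi_1(\Gamma/\tau)\to\mathbb{Z}_2$ and $\theta_2\colon B_2(G)\to\mathbb{Z}_2$ be induced by the classifying maps of these coverings (equivalently, a loop is sent to $0$ or $1$ according to whether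 its lifts are closed or not). Let $[\Gamma,G]$ be the set of based homotopy classes of based maps. The Borsuk–Ulam property is said to hold for $\alpha\in[\Gamma,G]$ if every representative $f\in\alpha$ satisfies $f(x)=f(\tau x)$ for some $x\in\Gamma$; otherwise it fails for $\alpha$. Then the sequences $$1\to\pi_1(\Gamma)\xrightarrow{\iota_1}\pi_1(\Gamma/\tau)\xrightarrow{\theta_1}\mathbb{Z}_2\to1,\qquad 1\to P_2(G)\xrightarrow{\iota_2}B_2(G)\xrightarrow{\theta_2}\mathbb{Z}_2\to1$$ are exact, and for every $\alpha\in[\Gamma,G]$ the Borsuk–Ulam property fails for $\alpha$ if and only if there are group homomorphisms $\varphi\colon\pi_1(\Gamma)\to P_2(G)$ and $\psi\colon\pi_1(\Gamma/\tau)\to B_2(G)$ such that $$(p_1)_\#\circ\varphi=\alpha_\#,\qquad \iota_2\circ\varphi=\psi\circ\iota_1,\qquad \theta_2\circ\psi=\theta_1 .$$ -/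

import Mathlib

open Topology

namespace GraphBU

/-- A finite connected graph, as a topological space: a connected Hausdorff space that carries a
finite CW structure without cells of dimension at least two. Loops and multiple edges are allowed,
and the structure is not part of the data. -/
class FiniteConnectedGraph (X : Type*) [TopologicalSpace X] : Prop
    extends T2Space X, ConnectedSpace X where
  exists_cw : ∃ _ : CWComplex (Set.univ : Set X),
    RelCWComplex.Finite (Set.univ : Set X) ∧
      ∀ n : ℕ, 2 ≤ n → IsEmpty (RelCWComplex.cell (Set.univ : Set X) n)

/-! ### Based homotopy classes -/

section BasedMaps

variable (X Y : Type*) [TopologicalSpace X] [TopologicalSpace Y] (x₀ : X) (y₀ : Y)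

/-- Based continuous maps `(X, x₀) → (Y, y₀)`. -/
def BasedMap := {f : C(X, Y) // f x₀ = y₀}

/-- Based homotopy. -/
def basedHomotopySetoid : Setoid (BasedMap X Y x₀ y₀) where
  r f g := f.1.HomotopicRel g.1 {x₀}
  iseqv := ⟨fun f => .refl f.1, fun h => h.symm, fun h h' => h.trans h'⟩

/-- The set `[X, Y]` of based homotopy classes of based maps. -/
def BasedHomotopyClass := Quotient (basedHomotopySetoid X Y x₀ y₀)

variable {X Y x₀ y₀}

/-- The homomorphism `f_# : π₁(X, x₀) → π₁(Y, y₀)` induced by a based map. -/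
noncomputable def BasedMap.induced (f : BasedMap X Y x₀ y₀) :
    FundamentalGroup X x₀ →* FundamentalGroup Y y₀ :=
  FundamentalGroup.mapOfEq f.1 f.2

/-- The based homotopy class of a based map. -/
def BasedMap.toClass (f : BasedMap X Y x₀ y₀) : BasedHomotopyClass X Y x₀ y₀ :=
  Quotient.mk (basedHomotopySetoid X Y x₀ y₀) f

theorem BasedMap.induced_eq_of_homotopic (f g : BasedMap X Y x₀ y₀)
    (h : f.1.HomotopicRel g.1 {x₀}) : f.induced = g.induced := by
  ext p
  obtain ⟨γ, rfl⟩ := Path.Homotopic.Quotient.mk_surjective p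
  rw [BasedMap.induced, BasedMap.induced, FundamentalGroup.mapOfEq_apply,
    FundamentalGroup.mapOfEq_apply]
  change Path.Homotopic.Quotient.mk _ = Path.Homotopic.Quotient.mk _
  rw [Path.Homotopic.Quotient.eq]
  obtain ⟨H⟩ := h
  refine ⟨⟨⟨⟨fun q => H (q.1, γ q.2), by fun_prop⟩, fun t => ?_, fun t => ?_⟩, fun s t ht => ?_⟩⟩
  · simp
  · simp
  · have hγ : γ t = x₀ := by
      rcases ht with rfl | ht
      · simp
      · rw [Set.mem_singleton_iff] at ht
        subst ht
        simp
    simpa [hγ] using H.eq_fst s (x := γ t) (by simp [hγ])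

/-- The homomorphism `α_# : π₁(X, x₀) → π₁(Y, y₀)` induced by a based homotopy class. -/
noncomputable def BasedHomotopyClass.induced (α : BasedHomotopyClass X Y x₀ y₀) :
    FundamentalGroup X x₀ →* FundamentalGroup Y y₀ :=
  Quotient.lift BasedMap.induced BasedMap.induced_eq_of_homotopic α

end BasedMaps

/-! ### Free involutions, their double coverings, and the classifying homomorphism -/

/-- A fixed-point free continuous involution of a space. -/
structure FreeInvolution (X : Type*) [TopologicalSpace X] where
  toMap : C(X, X)
  involutive : ∀ x, toMap (toMap x) = x
  free : ∀ x, toMap x ≠ x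

namespace FreeInvolution

variable {X : Type*} [TopologicalSpace X] (τ : FreeInvolution X)

/-- The action of `ℤ₂` whose nontrivial element acts by the involution. -/
@[reducible] def action : AddAction (ZMod 2) X where
  vadd a x := if a = 0 then x else τ.toMap x
  zero_vadd x := if_pos rfl
  add_vadd a b x := by
    change (if a + b = 0 then x else τ.toMap x) =
      if a = 0 then (if b = 0 then x else τ.toMap x)
        else τ.toMap (if b = 0 then x else τ.toMap x)
    have key : ∀ a b : ZMod 2, (a = 0 ∧ b = 0 ∧ a + b = 0) ∨ (a = 0 ∧ b ≠ 0 ∧ a + b ≠ 0) ∨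
      (a ≠ 0 ∧ b = 0 ∧ a + b ≠ 0) ∨ (a ≠ 0 ∧ b ≠ 0 ∧ a + b = 0) := by decide
    rcases key a b with h | h | h | h <;> simp [h, τ.involutive]

/-- The orbit relation `x ∼ y ↔ x = y ∨ x = τ y`. -/
def setoid : Setoid X where
  r x y := x = y ∨ x = τ.toMap y
  iseqv := by
    refine ⟨fun x => Or.inl rfl, ?_, ?_⟩
    · rintro x y (rfl | rfl)
      · exact Or.inl rfl
      · exact Or.inr (τ.involutive y).symm
    · rintro x y z (rfl | rfl) (rfl | rfl)
      · exact Or.inl rfl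
      · exact Or.inr rfl
      · exact Or.inr rfl
      · exact Or.inl (τ.involutive z)

/-- The orbit space `X / τ`, with the quotient topology. -/
def Orbit : Type _ := Quotient τ.setoid

instance : TopologicalSpace τ.Orbit := inferInstanceAs (TopologicalSpace (Quotient τ.setoid))

/-- The projection `X → X / τ`. -/
def proj : C(X, τ.Orbit) := ⟨Quotient.mk τ.setoid, continuous_quotient_mk'⟩

theorem isAddQuotientCoveringMap [T2Space X] :
    letI := τ.action
    IsAddQuotientCoveringMap τ.proj (ZMod 2) := by
  let _ := τ.action
  have hvadd : ∀ (a : ZMod 2) (x : X), a +ᵥ x = if a = 0 then x else τ.toMap x :=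
    fun _ _ => rfl
  refine { isQuotientMap_quotient_mk' (s := τ.setoid) with
    continuous_const_vadd := fun a => ?_
    apply_eq_iff_mem_orbit := fun {x y} => ?_
    disjoint := fun x => ?_ }
  · by_cases ha : a = 0
    · simpa [hvadd, ha] using continuous_id'
    · simpa [hvadd, ha] using τ.toMap.continuous
  · refine Iff.trans (Quotient.eq (r := τ.setoid)) ?_
    constructor
    · rintro (h | h)
      · exact ⟨0, by simp [h]⟩
      · exact ⟨1, by simp [hvadd, h]⟩
    · rintro ⟨a, ha⟩
      by_cases h0 : a = 0
      · exact Or.inl (by simpa [hvadd, h0] using ha.symm)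
      · exact Or.inr (by simpa [hvadd, h0] using ha.symm)
  · obtain ⟨U, V, hU, hV, hxU, hxV, hUV⟩ := t2_separation (τ.free x)
    refine ⟨V ∩ τ.toMap ⁻¹' U, Filter.inter_mem (hV.mem_nhds hxV)
      ((hU.preimage τ.toMap.continuous).mem_nhds hxU), fun a ha => ?_⟩
    by_contra h0
    obtain ⟨z, ⟨y, hy, rfl⟩, hz⟩ := ha
    have hz' : τ.toMap y ∈ V := by simpa [hvadd, h0] using hz.1
    exact Set.disjoint_left.mp hUV hy.2 hz'

/-- The homomorphism `π₁(X, x₀) → π₁(X / τ, [x₀])` induced by the double covering. -/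
noncomputable def projHom (x₀ : X) :
    FundamentalGroup X x₀ →* FundamentalGroup τ.Orbit (τ.proj x₀) :=
  FundamentalGroup.map τ.proj x₀

/-- The homomorphism `π₁(X / τ, [x₀]) → ℤ₂` induced by the classifying map of the double covering
`X → X / τ`, i.e. its monodromy: a loop class is sent to `0` or `1` according to whether its lift
starting at `x₀` ends at `x₀` or at `τ x₀`. The group `ℤ₂` is written multiplicatively. -/
noncomputable def classifyingHom [T2Space X] (x₀ : X) :
    FundamentalGroup τ.Orbit (τ.proj x₀) →* Multiplicative (ZMod 2) :=
  letI := τ.action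
  (MulOpposite.opMulEquiv (M := Multiplicative (ZMod 2))).symm.toMonoidHom.comp
    (τ.isAddQuotientCoveringMap.fundamentalGroupToMulOpposite (⟨x₀, rfl⟩ : τ.proj ⁻¹' {τ.proj x₀}))


end FreeInvolution

/-- `1 → A → B → C → 1` is a short exact sequence of groups. -/
def IsShortExact {A B C : Type*} [Group A] [Group B] [Group C] (i : A →* B) (p : B →* C) : Prop :=
  Function.Injective i ∧ i.range = p.ker ∧ Function.Surjective p

/-! ### The Borsuk-Ulam property -/

/-- The Borsuk-Ulam property for a based homotopy class, with respect to a free involution of the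
source. -/
def BorsukUlam {X Y : Type*} [TopologicalSpace X] [TopologicalSpace Y] {x₀ : X} {y₀ : Y}
    (τ : FreeInvolution X) (α : BasedHomotopyClass X Y x₀ y₀) : Prop :=
  ∀ f : BasedMap X Y x₀ y₀, f.toClass = α → ∃ x : X, f.1 x = f.1 (τ.toMap x)

/-! ### Configuration spaces of two points and two-strand braid groups -/

section Conf

variable (Y : Type*) [TopologicalSpace Y]

/-- The ordered configuration space of two distinct points of `Y`. -/
abbrev Conf₂ := {p : Y × Y // p.1 ≠ p.2}

/-- The involution `(x, y) ↦ (y, x)` of the ordered configuration space. -/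
def swap : FreeInvolution (Conf₂ Y) where
  toMap := ⟨fun c => ⟨c.1.swap, c.2.symm⟩, by fun_prop⟩
  involutive _ := rfl
  free c h := c.2 (congrArg (fun d : Conf₂ Y => d.1.2) h)

/-- The unordered configuration space of two distinct points of `Y`. -/
abbrev UConf₂ := (swap Y).Orbit

/-- The projection onto the first coordinate. -/
def fstProj : C(Conf₂ Y, Y) := ⟨fun c => c.1.1, by fun_prop⟩

variable {Y}

/-- The pure braid group on two strands, based at an ordered configuration. -/
abbrev PureBraidGroup (c : Conf₂ Y) := FundamentalGroup (Conf₂ Y) c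

/-- The full braid group on two strands, based at the unordered configuration underlying `c`. -/
abbrev BraidGroup (c : Conf₂ Y) := FundamentalGroup (UConf₂ Y) ((swap Y).proj c)

/-- The homomorphism `(p₁)_# : P₂(Y) → π₁(Y)`. -/
noncomputable def fstHom (c : Conf₂ Y) : PureBraidGroup c →* FundamentalGroup Y c.1.1 :=
  FundamentalGroup.map (fstProj Y) c

end Conf

end GraphBU

/-! ### Graphs as finite unions of arcs -/

namespace GraphBU

open scoped unitInterval
open Set

/-! A map `f` with `f x ≠ f (τ x)` for all `x` is the same thing as the equivariant map `F = (f, f ∘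
τ)` from `Γ` to `Conf₂ G`. The theorem translates such maps into homomorphisms. Both exact sequences
belong to free double coverings; their surjectivity needs `Γ` and `Conf₂ G` to be path connected.

From maps to homomorphisms, `F` and its quotient on orbit spaces induce the pair, except that `F x₀`
is `(g₀, f (τ x₀))` instead of `(g₀, g₁)`. Changing the base point leaves `(p₁)_#` intact if the
connecting path in `Conf₂ G` has null-homotopic first coordinate. Such paths exist when every point
of `G` is slidable (`IsEdgeSystem.isSlidable`), and this is where intervals are excluded.
Slidability spreads between adjacent edges, so one slidable edge suffices. It comes from an edge
whose endpoints can be joined off it, or from a vertex where three edge ends meet; if neither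
occurs, a maximal embedded arc of edges is all of `G`. Slidability also makes `Conf₂ G` path
connected.

From homomorphisms to maps, `Γ / τ` is again a graph, so `ψ` is induced by a map `k`
(`exists_map_of_hom`). The equation `ι₂ φ = ψ ι₁` lifts `k` to `F : Γ → Conf₂ G`, and `θ₂ ψ = θ₁`
forces `F` to be equivariant. The first coordinate of `F` has no coincidences and induces `α_#`. It
lies in `α` because based maps out of a graph, into any space, are determined up to based homotopy
by their homomorphism (`homotopicRel_of_mapOfEq_eq`).

Both facts about maps out of graphs rest on `path_induction`: the fundamental groupoid is generated
by segments of edges, so naturality need only be checked there. -/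

instance contractibleSpace_unitInterval : ContractibleSpace I :=
  (convex_Icc (0 : ℝ) 1).contractibleSpace ⟨0, by simp⟩

/-- A presentation of a space as a union of arcs `e i`, any two of which meet only in endpoints. -/
structure IsEdgeSystem {ι X : Type*} [TopologicalSpace X] (e : ι → C(I, X)) : Prop where
  intro ::
  cover : ∀ x, ∃ i s, e i s = x
  inj : ∀ {i j s t}, s ≠ 0 → s ≠ 1 → e i s = e j t → i = j ∧ s = t

/-- The endpoints of the edges. -/
def vertexSet {ι X : Type*} [TopologicalSpace X] (e : ι → C(I, X)) : Set X :=
  {x | ∃ i, x = e i 0 ∨ x = e i 1}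

namespace IsEdgeSystem

variable {ι κ X : Type*} [TopologicalSpace X] {e : ι → C(I, X)}

theorem inj' (he : IsEdgeSystem e) {i j s t} (ht : t ≠ 0) (ht' : t ≠ 1) (h : e i s = e j t) :
    i = j ∧ s = t := by
  obtain ⟨h1, h2⟩ := he.inj ht ht' h.symm
  exact ⟨h1.symm, h2.symm⟩

theorem comp_equiv (he : IsEdgeSystem e) (f : κ ≃ ι) : IsEdgeSystem (fun k => e (f k)) where
  cover x := by
    obtain ⟨i, s, h⟩ := he.cover x
    exact ⟨f.symm i, s, by simpa using h⟩
  inj h h' h'' := by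
    obtain ⟨h1, h2⟩ := he.inj h h' h''
    exact ⟨f.injective h1, h2⟩

theorem exists_fin [Finite ι] (he : IsEdgeSystem e) :
    ∃ (n : ℕ) (e' : Fin n → C(I, X)), IsEdgeSystem e' ∧ vertexSet e' = vertexSet e := by
  obtain ⟨n, ⟨f⟩⟩ := Finite.exists_equiv_fin ι
  refine ⟨n, fun k => e (f.symm k), he.comp_equiv f.symm, ?_⟩
  ext x
  constructor
  · rintro ⟨k, h⟩
    exact ⟨_, h⟩
  · rintro ⟨i, h⟩
    exact ⟨f i, by simpa using h⟩

theorem mem_vertexSet_or (he : IsEdgeSystem e) (x : X) :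
    x ∈ vertexSet e ∨ ∃ i s, s ≠ 0 ∧ s ≠ 1 ∧ e i s = x := by
  obtain ⟨i, s, h⟩ := he.cover x
  by_cases h0 : s = 0
  · exact Or.inl ⟨i, Or.inl (by rw [← h, h0])⟩
  by_cases h1 : s = 1
  · exact Or.inl ⟨i, Or.inr (by rw [← h, h1])⟩
  exact Or.inr ⟨i, s, h0, h1, h⟩

theorem apply_notMem_vertexSet (he : IsEdgeSystem e) {i s} (h0 : s ≠ 0) (h1 : s ≠ 1) :
    e i s ∉ vertexSet e := by
  rintro ⟨j, h | h⟩
  · exact h0 (he.inj h0 h1 h).2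
  · exact h1 (he.inj h0 h1 h).2

theorem apply_mem_vertexSet_iff (he : IsEdgeSystem e) {i s} :
    e i s ∈ vertexSet e ↔ s = 0 ∨ s = 1 := by
  constructor
  · intro h
    by_contra! h'
    exact he.apply_notMem_vertexSet h'.1 h'.2 h
  · rintro (rfl | rfl)
    · exact ⟨i, Or.inl rfl⟩
    · exact ⟨i, Or.inr rfl⟩

theorem finite_vertexSet [Finite ι] (e : ι → C(I, X)) : (vertexSet e).Finite := by
  have : vertexSet e ⊆ range (fun i => e i 0) ∪ range (fun i => e i 1) := by
    rintro x ⟨i, rfl | rfl⟩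
    · exact Or.inl ⟨i, rfl⟩
    · exact Or.inr ⟨i, rfl⟩
  exact ((finite_range _).union (finite_range _)).subset this

theorem isClosed_range [T2Space X] (f : C(I, X)) : IsClosed (range f) :=
  (isCompact_range f.continuous).isClosed

/-- In a connected space, a property of edges that passes between edges that meet holds for all
edges if it holds for one. -/
theorem edge_induction [Finite ι] [T2Space X] [PreconnectedSpace X] (he : IsEdgeSystem e)
    {P : ι → Prop} {i₀ : ι} (h₀ : P i₀) (h : ∀ i j s t, P i → e i s = e j t → P j) (j : ι) :
    P j := by
  by_contra hj
  have hA : IsClosed (⋃ i ∈ {i | P i}, range (e i)) :=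
    (toFinite {i | P i}).isClosed_biUnion fun i _ => isClosed_range _
  have hB : IsClosed (⋃ i ∈ {i | ¬ P i}, range (e i)) :=
    (toFinite {i | ¬ P i}).isClosed_biUnion fun i _ => isClosed_range _
  have := isPreconnected_closed_iff.mp (isPreconnected_univ (α := X)) _ _ hA hB
    (fun x _ => ?_) ⟨e i₀ 0, trivial, ?_⟩ ⟨e j 0, trivial, ?_⟩
  · obtain ⟨x, -, hxA, hxB⟩ := this
    simp only [mem_iUnion] at hxA hxB
    obtain ⟨i, hi, s, rfl⟩ := hxA
    obtain ⟨k, hk, t, hst⟩ := hxB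
    exact hk (h i k s t hi hst.symm)
  · obtain ⟨i, s, rfl⟩ := he.cover x
    by_cases hi : P i
    · exact Or.inl (mem_biUnion (x := i) hi ⟨s, rfl⟩)
    · exact Or.inr (mem_biUnion (x := i) hi ⟨s, rfl⟩)
  · exact mem_biUnion (x := i₀) h₀ ⟨0, rfl⟩
  · exact mem_biUnion (x := j) hj ⟨0, rfl⟩

theorem nonempty_index [Nonempty X] (he : IsEdgeSystem e) : Nonempty ι :=
  (he.cover (Classical.arbitrary X)).nonempty

/-- In a connected space, an equivalence relation that identifies the points of each edge identifies
all points. -/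
theorem equivalence_induction [Finite ι] [T2Space X] [PreconnectedSpace X] (he : IsEdgeSystem e)
    {r : X → X → Prop} (hr : Equivalence r) (h : ∀ i s t, r (e i s) (e i t)) (x y : X) :
    r x y := by
  obtain ⟨i, s, rfl⟩ := he.cover x
  obtain ⟨j, t, rfl⟩ := he.cover y
  refine he.edge_induction (P := fun j => ∀ t, r (e i s) (e j t)) (h i s) ?_ j t
  intro j k u v hj hjk t
  exact hr.trans (hj u) (hjk ▸ h k v t)

theorem pathConnectedSpace [Finite ι] [T2Space X] [ConnectedSpace X] (he : IsEdgeSystem e) :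
    PathConnectedSpace X where
  nonempty := inferInstance
  joined := he.equivalence_induction ⟨Joined.refl, Joined.symm, Joined.trans⟩ fun i s t =>
    ⟨(PathConnectedSpace.somePath s t).map (e i).continuous⟩

end IsEdgeSystem

/-- The parametrization of `[-1, 1]` by the unit interval. -/
noncomputable def unitIntervalToBall (s : I) : Fin 1 → ℝ := fun _ => 2 * (s : ℝ) - 1

theorem norm_unitIntervalToBall (s : I) : ‖unitIntervalToBall s‖ = |2 * (s : ℝ) - 1| := by
  simp [unitIntervalToBall, Pi.norm_def]

-- The edges are the characteristic maps of the 1-cells, and disjointness of open cells gives `inj`.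
-- A 0-cell on no edge would be open, its complement being the closed union of the edges and the
-- other 0-cells; connectedness and `Nontrivial X` exclude this.
open RelCWComplex Metric in
theorem FiniteConnectedGraph.exists_isEdgeSystem (X : Type*) [TopologicalSpace X]
    [FiniteConnectedGraph X] [Nontrivial X] :
    ∃ (n : ℕ) (e : Fin n → C(I, X)), IsEdgeSystem e := by
  obtain ⟨hC, hfin, hdim⟩ := FiniteConnectedGraph.exists_cw (X := X)
  have hf : ∀ n, Finite (cell (univ : Set X) n) := hfin.toFiniteType.finite_cell
  have hcont : Continuous unitIntervalToBall := by
    unfold unitIntervalToBall; fun_prop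
  have hmem : ∀ s, unitIntervalToBall s ∈ closedBall (0 : Fin 1 → ℝ) 1 := fun s => by
    rw [mem_closedBall_zero_iff, norm_unitIntervalToBall, abs_le]
    constructor <;> linarith [s.2.1, s.2.2]
  have hmem' : ∀ s, s ≠ 0 → s ≠ 1 → unitIntervalToBall s ∈ ball (0 : Fin 1 → ℝ) 1 :=
    fun s h0 h1 => by
      rw [mem_ball_zero_iff, norm_unitIntervalToBall, abs_lt]
      have := unitInterval.pos_iff_ne_zero.mpr h0
      have := unitInterval.lt_one_iff_ne_one.mpr h1
      have h2 : (0 : ℝ) < s := by assumption_mod_cast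
      have h3 : (s : ℝ) < 1 := by assumption_mod_cast
      constructor <;> linarith
  have hinj : ∀ s t, unitIntervalToBall s = unitIntervalToBall t → s = t := fun s t h => by
    have := congrFun h 0
    simp only [unitIntervalToBall] at this
    exact Subtype.ext (by linarith)
  have hsurj : ∀ v ∈ closedBall (0 : Fin 1 → ℝ) 1, ∃ s, unitIntervalToBall s = v := fun v hv => by
    have h := (abs_le.mp ((norm_le_pi_norm v 0).trans (mem_closedBall_zero_iff.mp hv)))
    refine ⟨⟨(v 0 + 1) / 2, by linarith [h.1], by linarith [h.2]⟩, ?_⟩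
    ext k
    obtain rfl : k = 0 := Subsingleton.elim _ _
    simp only [unitIntervalToBall]
    ring
  let e : cell (univ : Set X) 1 → C(I, X) := fun i =>
    ⟨fun s => RelCWComplex.map 1 i (unitIntervalToBall s),
      (RelCWComplex.continuousOn 1 i).comp_continuous hcont hmem⟩
  have hend : ∀ i s, s = 0 ∨ s = 1 → ∃ j : cell (univ : Set X) 0,
      e i s ∈ openCell (C := (univ : Set X)) 0 j := fun i s hs => by
    obtain ⟨x, y, hxy⟩ := CWComplex.exists_cellFrontier_one_eq i
    have : e i s ∈ cellFrontier (C := (univ : Set X)) 1 i := by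
      refine ⟨_, ?_, rfl⟩
      rw [mem_sphere_zero_iff_norm, norm_unitIntervalToBall]
      rcases hs with rfl | rfl <;> norm_num
    rw [hxy, closedCell_zero_eq_singleton, closedCell_zero_eq_singleton] at this
    simp only [openCell_zero_eq_singleton]
    exact this.elim (fun h => ⟨x, h⟩) fun h => ⟨y, h⟩
  have hinj : ∀ {i j s t}, s ≠ 0 → s ≠ 1 → e i s = e j t → i = j ∧ s = t := by
    intro i j s t hs hs' h
    have h1 : e i s ∈ openCell (C := (univ : Set X)) 1 i := ⟨_, hmem' s hs hs', rfl⟩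
    by_cases ht : t = 0 ∨ t = 1
    · obtain ⟨k, hk⟩ := hend j t ht
      rw [← h] at hk
      have := eq_of_not_disjoint_openCell (not_disjoint_iff.mpr ⟨_, h1, hk⟩)
      simp at this
    · push Not at ht
      have h2 : e j t ∈ openCell (C := (univ : Set X)) 1 j := ⟨_, hmem' t ht.1 ht.2, rfl⟩
      rw [← h] at h2
      have := eq_of_not_disjoint_openCell (not_disjoint_iff.mpr ⟨_, h1, h2⟩)
      obtain rfl : i = j := by simpa using this
      refine ⟨rfl, hinj _ _ ?_⟩
      refine (RelCWComplex.map 1 i).injOn ?_ ?_ h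
      · rw [RelCWComplex.source_eq]; exact hmem' s hs hs'
      · rw [RelCWComplex.source_eq]; exact hmem' t ht.1 ht.2
  have hcov : ∀ x : X, (∃ j : cell (univ : Set X) 0, x = RelCWComplex.map 0 j ![]) ∨
      ∃ i s, e i s = x := fun x => by
    have hx : x ∈ ⋃ (n : ℕ) (j : cell (univ : Set X) n), closedCell (C := (univ : Set X)) n j := by
      rw [CWComplex.union]; trivial
    simp only [mem_iUnion] at hx
    obtain ⟨n, j, hx⟩ := hx
    rcases n with _ | _ | n
    · rw [closedCell_zero_eq_singleton] at hx
      exact Or.inl ⟨j, hx⟩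
    · obtain ⟨v, hv, rfl⟩ := hx
      obtain ⟨s, rfl⟩ := hsurj v hv
      exact Or.inr ⟨j, s, rfl⟩
    · exact ((hdim (n + 2) (by omega)).false j).elim
  have he : IsEdgeSystem e := by
    refine ⟨fun x => ?_, hinj⟩
    by_contra hx
    obtain ⟨j, rfl⟩ := (hcov x).resolve_right hx
    set x := RelCWComplex.map (C := (univ : Set X)) 0 j ![] with hxdef
    have hcl : IsClosed ((⋃ i, range (e i)) ∪
        (range (fun j : cell (univ : Set X) 0 => RelCWComplex.map 0 j ![]) \ {x})) :=
      (isClosed_iUnion_of_finite fun i => IsEdgeSystem.isClosed_range _).union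
        ((finite_range _).subset sdiff_subset).isClosed
    have hopen : IsOpen ({x} : Set X) := by
      rw [← isClosed_compl_iff]
      convert hcl using 1
      ext y
      constructor
      · intro hy
        rcases hcov y with ⟨k, rfl⟩ | ⟨i, s, rfl⟩
        · exact Or.inr ⟨⟨k, rfl⟩, hy⟩
        · exact Or.inl (mem_iUnion.mpr ⟨i, s, rfl⟩)
      · rintro (hy | hy) (hyx : y = x)
        · obtain ⟨i, s, h⟩ := mem_iUnion.mp hy
          exact hx ⟨i, s, h.trans hyx⟩
        · exact hy.2 hyx
    have := IsClopen.eq_univ ⟨isClosed_singleton, hopen⟩ ⟨x, rfl⟩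
    obtain ⟨y, hy⟩ := exists_ne x
    exact hy (this ▸ mem_univ y : y ∈ ({x} : Set X))
  obtain ⟨n, e', he', -⟩ := he.exists_fin
  exact ⟨n, e', he'⟩

end GraphBU

/-! ### Gluing along edges and generation of the fundamental groupoid -/

namespace GraphBU

open scoped unitInterval
open Set

section Segment

variable {X Y : Type*} [TopologicalSpace X] [TopologicalSpace Y]

/-- The path obtained by restricting `f` to the segment from `s` to `t`. -/
def segment (f : C(I, X)) (s t : I) : Path (f s) (f t) where
  toFun := f ∘ Icc.convexComb s t
  source' := by simp
  target' := by simp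

theorem segment_apply (f : C(I, X)) (s t u : I) : segment f s t u = f (Icc.convexComb s t u) := rfl

/-- The homotopy class of a segment. -/
def segmentClass (f : C(I, X)) (s t : I) : Path.Homotopic.Quotient (f s) (f t) :=
  .mk (segment f s t)

open Path.Homotopic.Quotient

/-- The interval is contractible, so a path class in it is determined by its endpoints. -/
theorem segmentClass_eq_map (f : C(I, X)) (s t : I) (γ : Path.Homotopic.Quotient s t) :
    segmentClass f s t = γ.map f := by
  have : segmentClass f s t = map (mk (segment (.id I) s t)) f := rfl
  rw [this]
  congr 1
  exact Subsingleton.elim _ _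

theorem segmentClass_self (f : C(I, X)) (s : I) : segmentClass f s s = .refl (f s) :=
  segmentClass_eq_map f s s (.refl s)

theorem segmentClass_trans (f : C(I, X)) (s t u : I) :
    (segmentClass f s t).trans (segmentClass f t u) = segmentClass f s u := by
  have h : ∀ (γ : Path s t) (δ : Path t u), ((mk γ).map f).trans ((mk δ).map f) =
      ((mk γ).trans (mk δ)).map f := fun γ δ => by
    rw [← mk_trans, ← mk_map, ← mk_map, ← mk_map, Path.map_trans, mk_trans]
  exact (h (segment (.id I) s t) (segment (.id I) t u)).trans (segmentClass_eq_map f s u _).symm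

theorem range_segment_subset (f : C(I, X)) {s t : I} (h : s ≤ t) {u : I} :
    ∃ v ∈ Icc s t, segment f s t u = f v :=
  ⟨_, ⟨Icc.le_convexComb h u, Icc.convexComb_le h u⟩, rfl⟩

end Segment

namespace IsEdgeSystem

variable {ι X Y Z : Type*} [TopologicalSpace X] [TopologicalSpace Y] [TopologicalSpace Z]
  {e : ι → C(I, X)}

/-- A continuous surjection from a compact space to a Hausdorff space is closed. The factor `Z` is
there so that homotopies can be glued too. -/
theorem isQuotientMap_sigma_prod [Finite ι] [T2Space X] [CompactSpace Z] [T2Space Z]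
    (he : IsEdgeSystem e) :
    IsQuotientMap (fun p : Σ _ : ι, I × Z => (e p.1 p.2.1, p.2.2)) := by
  have hc : Continuous (fun p : Σ _ : ι, I × Z => (e p.1 p.2.1, p.2.2)) := by
    refine continuous_sigma fun i => ?_
    fun_prop
  refine hc.isClosedMap.isQuotientMap hc ?_
  rintro ⟨x, z⟩
  obtain ⟨i, s, rfl⟩ := he.cover x
  exact ⟨⟨i, s, z⟩, rfl⟩

theorem isQuotientMap_sigma [Finite ι] [T2Space X] (he : IsEdgeSystem e) :
    IsQuotientMap (fun p : Σ _ : ι, I => e p.1 p.2) := by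
  have hc : Continuous (fun p : Σ _ : ι, I => e p.1 p.2) := by
    refine continuous_sigma fun i => ?_
    fun_prop
  refine hc.isClosedMap.isQuotientMap hc ?_
  intro x
  obtain ⟨i, s, rfl⟩ := he.cover x
  exact ⟨⟨i, s⟩, rfl⟩

theorem locallyPathConnectedSpace [Finite ι] [T2Space X] (he : IsEdgeSystem e) :
    LocallyPathConnectedSpace X := by
  have : LocallyPathConnectedSpace I := (convex_Icc (0 : ℝ) 1).locallyPathConnectedSpace
  exact he.isQuotientMap_sigma.locallyPathConnectedSpace

/-- Compatibility matters only at endpoints: an interior parameter determines both the edge and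
itself. -/
theorem exists_glue_prod [Finite ι] [T2Space X] [CompactSpace Z] [T2Space Z]
    (he : IsEdgeSystem e) (k : ι → C(I × Z, Y))
    (hk : ∀ i j s t z, (s = 0 ∨ s = 1) → (t = 0 ∨ t = 1) → e i s = e j t →
      k i (s, z) = k j (t, z)) :
    ∃ K : C(X × Z, Y), ∀ i s z, K (e i s, z) = k i (s, z) := by
  let g : C(Σ _ : ι, I × Z, Y) :=
    ⟨fun p => k p.1 p.2, continuous_sigma fun i => (k i).continuous⟩
  let q : C(Σ _ : ι, I × Z, X × Z) := ⟨_, (he.isQuotientMap_sigma_prod (Z := Z)).continuous⟩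
  have hq : IsQuotientMap q := he.isQuotientMap_sigma_prod
  have hgq : Function.FactorsThrough g q := by
    rintro ⟨i, s, z⟩ ⟨j, t, z'⟩ h
    obtain ⟨hst, rfl⟩ : e i s = e j t ∧ z = z' := Prod.ext_iff.mp h
    clear h
    change k i (s, z) = k j (t, z)
    by_cases hs : s = 0 ∨ s = 1
    · by_cases ht : t = 0 ∨ t = 1
      · exact hk i j s t z hs ht hst
      · push Not at ht
        obtain ⟨rfl, rfl⟩ := he.inj' ht.1 ht.2 hst
        rfl
    · push Not at hs
      obtain ⟨rfl, rfl⟩ := he.inj hs.1 hs.2 hst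
      rfl
  refine ⟨hq.lift g hgq, fun i s z => ?_⟩
  exact DFunLike.congr_fun (hq.lift_comp g hgq) (⟨i, s, z⟩ : Σ _ : ι, I × Z)

theorem exists_glue [Finite ι] [T2Space X] (he : IsEdgeSystem e) (k : ι → C(I, Y))
    (hk : ∀ i j s t, (s = 0 ∨ s = 1) → (t = 0 ∨ t = 1) → e i s = e j t → k i s = k j t) :
    ∃ K : C(X, Y), ∀ i s, K (e i s) = k i s := by
  obtain ⟨K, hK⟩ := he.exists_glue_prod (Z := Unit) (fun i => (k i).comp ContinuousMap.fst)
    fun i j s t _ hs ht h => hk i j s t hs ht h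
  exact ⟨K.comp ⟨fun x => (x, ()), by fun_prop⟩, fun i s => hK i s ()⟩

/-- A continuous map into an open edge lifts to the parameter interval. -/
theorem exists_lift_edge [T2Space X] (he : IsEdgeSystem e) (i : ι) (γ : Z → X) (hγ : Continuous γ)
    (h : ∀ z, ∃ s, s ≠ 0 ∧ s ≠ 1 ∧ e i s = γ z) :
    ∃ φ : C(Z, I), ∀ z, φ z ≠ 0 ∧ φ z ≠ 1 ∧ e i (φ z) = γ z := by
  choose φ h0 h1 hφ using h
  refine ⟨⟨φ, ?_⟩, fun z => ⟨h0 z, h1 z, hφ z⟩⟩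
  rw [continuous_iff_isClosed]
  intro C hC
  have : φ ⁻¹' C = γ ⁻¹' (e i '' C) := by
    ext z
    constructor
    · intro hz
      exact ⟨φ z, hz, hφ z⟩
    · rintro ⟨t, ht, htz⟩
      rw [← hφ z] at htz
      obtain ⟨-, rfl⟩ := he.inj' (h0 z) (h1 z) htz
      exact ht
  rw [this]
  exact ((hC.isCompact.image (e i).continuous).isClosed).preimage hγ

theorem isOpen_openEdge [Finite ι] [T2Space X] (he : IsEdgeSystem e) (i : ι) :
    IsOpen {x | ∃ s, s ≠ 0 ∧ s ≠ 1 ∧ e i s = x} := by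
  have : {x | ∃ s, s ≠ 0 ∧ s ≠ 1 ∧ e i s = x}ᶜ =
      (⋃ j ∈ {j | j ≠ i}, range (e j)) ∪ {e i 0, e i 1} := by
    ext x
    constructor
    · intro hx
      obtain ⟨j, t, rfl⟩ := he.cover x
      by_cases hj : j = i
      · subst hj
        by_cases h0 : t = 0
        · subst h0; simp
        by_cases h1 : t = 1
        · subst h1; simp
        exact (hx ⟨t, h0, h1, rfl⟩).elim
      · exact Or.inl (mem_biUnion (x := j) hj ⟨t, rfl⟩)
    · rintro h ⟨s, h0, h1, rfl⟩
      rcases h with h | h | h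
      · simp only [mem_iUnion] at h
        obtain ⟨j, hj, t, h⟩ := h
        exact hj (he.inj' h0 h1 h).1
      · exact h0 (he.inj h0 h1 h).2
      · exact h1 (he.inj h0 h1 h).2
  rw [← isClosed_compl_iff, this]
  exact ((toFinite {j | j ≠ i}).isClosed_biUnion fun j _ => isClosed_range _).union
    (toFinite _).isClosed

/-- The map of the unit interval that stretches the middle third over the whole interval. -/
noncomputable def stretch : C(I, I) :=
  ⟨fun s => projIcc 0 1 zero_le_one (3 * (s : ℝ) - 1), continuous_projIcc.comp (by fun_prop)⟩

theorem stretch_of_le {s : I} (h : (s : ℝ) ≤ 1 / 3) : stretch s = 0 :=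
  projIcc_of_le_left zero_le_one (by linarith)

theorem stretch_of_ge {s : I} (h : 2 / 3 ≤ (s : ℝ)) : stretch s = 1 :=
  projIcc_of_right_le zero_le_one (by linarith)

open Path.Homotopic.Quotient in
/-- Induction principle for homotopy classes of paths in a graph: they are generated by the
segments of the edges. -/
theorem path_induction [Finite ι] [T2Space X] (he : IsEdgeSystem e)
    {P : ∀ x y : X, Path.Homotopic.Quotient x y → Prop}
    (hseg : ∀ i s t, P _ _ (segmentClass (e i) s t))
    (htrans : ∀ x y z γ δ, P x y γ → P y z δ → P x z (γ.trans δ)) (x y : X)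
    (γ : Path.Homotopic.Quotient x y) : P x y γ := by
  -- A path that factors through a single edge is a segment, up to homotopy.
  have htrack : ∀ {a b : X} (δ : Path a b) (i : ι) (φ : C(I, I)), (∀ t, δ t = e i (φ t)) →
      P a b (mk δ) := by
    intro a b δ i φ hφ
    obtain rfl : e i (φ 0) = a := by rw [← hφ, δ.source]
    obtain rfl : e i (φ 1) = b := by rw [← hφ, δ.target]
    convert hseg i (φ 0) (φ 1) using 1
    refine Eq.trans ?_ (segmentClass_eq_map (e i) (φ 0) (φ 1) (mk ⟨φ, rfl, rfl⟩)).symm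
    rw [← mk_map]
    congr 1
    ext t
    exact hφ t
  -- a homotopy from the identity that collapses a neighbourhood of the vertices
  obtain ⟨K, hK⟩ := he.exists_glue_prod (Z := I)
    (fun i => (e i).comp ⟨fun p : I × I => Icc.convexComb p.1 (stretch p.1) p.2,
      Icc.continuous_convexComb_prod.comp (g := fun x : I × I × I => Icc.convexComb x.1 x.2.1 x.2.2)
        (f := fun p : I × I => (p.1, stretch p.1, p.2)) (by fun_prop)⟩) (by
    intro i j s t z hs ht h
    have : ∀ s : I, s = 0 ∨ s = 1 → Icc.convexComb s (stretch s) z = s := by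
      rintro _ (rfl | rfl)
      · rw [stretch_of_le (by simp)]; simp
      · rw [stretch_of_ge (by simp; norm_num)]; simp
    change e i (Icc.convexComb s (stretch s) z) = e j (Icc.convexComb t (stretch t) z)
    rw [this s hs, this t ht, h])
  replace hK : ∀ i s z, K (e i s, z) = e i (Icc.convexComb s (stretch s) z) := hK
  let r : C(X, X) := K.comp ⟨fun x => (x, 1), by fun_prop⟩
  have hr : ∀ i s, r (e i s) = e i (stretch s) := fun i s => (hK i s 1).trans (by simp)
  let F : ContinuousMap.Homotopy (.id X) r :=
    { toFun := fun p => K (p.2, p.1)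
      continuous_toFun := by fun_prop
      map_zero_left := fun x => by
        obtain ⟨i, s, rfl⟩ := he.cover x
        rw [hK]; simp
      map_one_left := fun x => rfl }
  have hF : ∀ (i s z), F (z, e i s) = e i (Icc.convexComb s (stretch s) z) := fun i s z => hK i s z
  -- `stretch` sends everything outside the middle thirds to an endpoint, so `r` maps the complement
  -- of `C` into the vertices.
  let C : Set X := ⋃ i, e i '' {s | 1 / 3 ≤ (s : ℝ) ∧ (s : ℝ) ≤ 2 / 3}
  have hC : IsClosed C := by
    refine isClosed_iUnion_of_finite fun i => (IsCompact.image ?_ (e i).continuous).isClosed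
    refine IsClosed.isCompact ?_
    exact (isClosed_le continuous_const continuous_subtype_val).inter
      (isClosed_le continuous_subtype_val continuous_const)
  have hrC : ∀ x ∉ C, r x ∈ vertexSet e := by
    intro x hx
    obtain ⟨i, s, rfl⟩ := he.cover x
    rw [hr]
    by_cases h1 : (s : ℝ) ≤ 1 / 3
    · rw [stretch_of_le h1]; exact ⟨i, Or.inl rfl⟩
    by_cases h2 : 2 / 3 ≤ (s : ℝ)
    · rw [stretch_of_ge h2]; exact ⟨i, Or.inr rfl⟩
    push Not at h1 h2
    exact (hx (mem_iUnion.mpr ⟨i, s, ⟨h1.le, h2.le⟩, rfl⟩)).elim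
  -- Off `C`, the path `r ∘ δ` is connected inside a finite set, hence constant. By naturality of
  -- the homotopy `F`, `δ` is then homotopic to the track of `a`, a constant path and the reversed
  -- track of `b`, each inside one edge.
  have hstar : ∀ {a b : X} (δ : Path a b), (∀ t, δ t ∉ C) → P a b (mk δ) := by
    intro a b δ hδ
    have hconst : ∀ t, r (δ t) = r (δ 0) := by
      intro t
      refine (isPreconnected_univ (α := I)).constant_of_mapsTo
        (T := vertexSet e) (finite_vertexSet e).isDiscrete (f := fun t => r (δ t))
        (by fun_prop) ?_ (mem_univ _) (mem_univ _)
      exact fun t _ => hrC _ (hδ t)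
    have h := Path.Homotopic.map_trans_evalAt F δ
    rw [← Path.Homotopic.Quotient.eq, mk_trans, mk_trans] at h
    have h' : mk δ = ((mk (F.evalAt a)).trans (mk (δ.map (map_continuous r)))).trans
        (mk (F.evalAt b).symm) := by
      rw [← h, mk_symm]
      rw [Path.Homotopic.Quotient.trans_assoc, Path.Homotopic.Quotient.trans_symm,
        Path.Homotopic.Quotient.trans_refl]
      rfl
    rw [h']
    obtain ⟨i, s, rfl⟩ := he.cover a
    obtain ⟨j, t, rfl⟩ := he.cover b
    refine htrans _ _ _ _ _ (htrans _ _ _ _ _ (htrack _ i ⟨_, Icc.continuous_convexComb s (stretch s)⟩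
      fun u => hF i s u) (htrack _ i (.const I (stretch s)) fun u => ?_))
      (htrack _ j (ContinuousMap.comp ⟨_, Icc.continuous_convexComb t (stretch t)⟩ ⟨unitInterval.symm, by fun_prop⟩)
      fun u => hF j t (unitInterval.symm u))
    change r (δ u) = e i (stretch s)
    rw [hconst, δ.source, hr]
  have hedge : ∀ {a b : X} (δ : Path a b) (i : ι), (∀ t, ∃ s, s ≠ 0 ∧ s ≠ 1 ∧ e i s = δ t) →
      P a b (mk δ) := by
    intro a b δ i hδ
    obtain ⟨φ, hφ⟩ := he.exists_lift_edge i δ δ.continuous hδ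
    exact htrack δ i φ fun t => (hφ t).2.2.symm
  obtain ⟨γ, rfl⟩ := mk_surjective γ
  have key : ∀ f : C(I, X), P (f 0) (f 1) (segmentClass f 0 1) := by
    intro f
    -- Here `none` stands for the neighbourhood `Cᶜ` of the vertices and `some i` for the open edge
    -- `i`. A fine subdivision of `I` puts each piece of the path in one of these sets.
    let c : Option ι → Set I := fun o => o.elim (f ⁻¹' Cᶜ) fun i => f ⁻¹' {x | ∃ s, s ≠ 0 ∧ s ≠ 1 ∧ e i s = x}
    obtain ⟨t, ht0, htm, ⟨n, hn⟩, ht⟩ := exists_monotone_Icc_subset_open_cover_unitInterval (c := c)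
      (by
        rintro (_ | i)
        · exact hC.isOpen_compl.preimage f.continuous
        · exact (he.isOpen_openEdge i).preimage f.continuous)
      (by
        intro u _
        rcases he.mem_vertexSet_or (f u) with h | ⟨i, s, h0, h1, hs⟩
        · refine mem_iUnion.mpr ⟨none, fun hu => ?_⟩
          obtain ⟨i, s, ⟨h1, h2⟩, hs⟩ := mem_iUnion.mp hu
          rw [← hs, he.apply_mem_vertexSet_iff] at h
          rcases h with rfl | rfl
          · norm_num at h1
          · norm_num at h2
        · exact mem_iUnion.mpr ⟨some i, s, h0, h1, hs⟩)
    have : ∀ m, P (f 0) (f (t m)) (segmentClass f 0 (t m)) := by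
      intro m
      induction m with
      | zero =>
        rw [ht0, segmentClass_self]
        obtain ⟨i, s, h⟩ := he.cover (f 0)
        exact htrack (Path.refl (f 0)) i (.const I s) fun _ => h.symm
      | succ m ih =>
        rw [← segmentClass_trans f 0 (t m)]
        refine htrans _ _ _ _ _ ih ?_
        obtain ⟨o, ho⟩ := ht m
        have hmem : ∀ u, Icc.convexComb (t m) (t (m + 1)) u ∈ c o := fun u =>
          ho ⟨Icc.le_convexComb (htm m.le_succ) u, Icc.convexComb_le (htm m.le_succ) u⟩
        rcases o with _ | i
        · exact hstar _ hmem
        · exact hedge _ i hmem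
    have := this n
    rwa [hn n le_rfl] at this
  obtain ⟨f, rfl, rfl⟩ := γ
  have h : (mk ⟨f, rfl, rfl⟩ : Path.Homotopic.Quotient (f 0) (f 1)) = segmentClass f 0 1 := by
    refine congrArg mk ?_
    ext t
    simp [segment_apply]
  have hP := key f
  rw [← h] at hP
  exact hP

end IsEdgeSystem

end GraphBU

/-! ### Maps out of graphs and homomorphisms of fundamental groups -/

namespace GraphBU

open scoped unitInterval
open Set

section Square

variable {Y : Type*} [TopologicalSpace Y]

/-- A homotopy between the two ways around a square can be reparametrized to a map of the
square. -/
theorem exists_square_filling {a b c d : Y} (p : Path a b) (q : Path b d) (r : Path a c)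
    (s : Path c d) (h : (p.trans q).Homotopic (r.trans s)) :
    ∃ k : C(I × I, Y), ∀ t, k (t, 0) = p t ∧ k (1, t) = q t ∧ k (0, t) = r t ∧ k (t, 1) = s t := by
  obtain ⟨H⟩ := h
  -- the two coordinates of the path along the bottom and the right side
  let A : ℝ → ℝ := fun w => min (2 * w) 1
  let B : ℝ → ℝ := fun w => max (2 * w - 1) 0
  have hA : ∀ w : I, A w ∈ Icc (0 : ℝ) 1 := fun w =>
    ⟨le_min (by linarith [w.2.1]) zero_le_one, min_le_right _ _⟩
  have hB : ∀ w : I, B w ∈ Icc (0 : ℝ) 1 := fun w =>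
    ⟨le_max_right _ _, max_le (by linarith [w.2.2]) zero_le_one⟩
  have hAB : ∀ w, A w + B w = 2 * w := fun w => by
    simp only [A, B]
    rcases le_total (2 * w) 1 with h | h
    · rw [min_eq_left h, max_eq_right (by linarith)]; ring
    · rw [min_eq_right h, max_eq_left (by linarith)]; ring
  -- For fixed `w`, `φ` runs linearly from `(A w, B w)` on the bottom and right sides to its mirror
  -- image on the left and top sides. It fails to be injective only at `w = 0` and `w = 1`, where `A
  -- w = B w` and `H` does not depend on the other variable; so `H` descends along `φ`.
  let φ : I × I → I × I := fun x =>
    (Icc.convexComb ⟨A x.2, hA x.2⟩ ⟨B x.2, hB x.2⟩ x.1,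
      Icc.convexComb ⟨B x.2, hB x.2⟩ ⟨A x.2, hA x.2⟩ x.1)
  have hφc : Continuous φ := by
    have h1 : Continuous fun x : I × I => (⟨A x.2, hA x.2⟩ : I) := by
      refine Continuous.subtype_mk ?_ _
      fun_prop
    have h2 : Continuous fun x : I × I => (⟨B x.2, hB x.2⟩ : I) := by
      refine Continuous.subtype_mk ?_ _
      fun_prop
    refine Continuous.prodMk ?_ ?_
    · exact Icc.continuous_convexComb_prod.comp (h1.prodMk (h2.prodMk continuous_fst))
    · exact Icc.continuous_convexComb_prod.comp (h2.prodMk (h1.prodMk continuous_fst))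
  have h1 : ∀ x, ((φ x).1 : ℝ) = (1 - x.1) * A x.2 + x.1 * B x.2 := fun x => rfl
  have h2 : ∀ x, ((φ x).2 : ℝ) = (1 - x.1) * B x.2 + x.1 * A x.2 := fun x => rfl
  have hsurj : Function.Surjective φ := by
    rintro ⟨t, s⟩
    let w : I := ⟨((t : ℝ) + s) / 2, by linarith [t.2.1, s.2.1], by linarith [t.2.2, s.2.2]⟩
    have hw : 2 * (w : ℝ) = t + s := by simp only [w]; ring
    have hm : |(t : ℝ) - s| ≤ A w - B w := by
      have : A w - B w = min ((t : ℝ) + s) (2 - (t + s)) := by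
        simp only [A, B, hw]
        rcases le_total ((t : ℝ) + s) 1 with h | h
        · rw [min_eq_left h, max_eq_right (by linarith), min_eq_left (by linarith)]; ring
        · rw [min_eq_right h, max_eq_left (by linarith), min_eq_right (by linarith)]; ring
      rw [this, abs_le]
      have := t.2.1; have := t.2.2; have := s.2.1; have := s.2.2
      constructor
      · rw [neg_le]
        exact le_min (by linarith) (by linarith)
      · exact le_min (by linarith) (by linarith)
    obtain ⟨hm1, hm2⟩ := abs_le.mp hm
    -- If `A w = B w`, the bound `hm` forces `t = s`, and any `u` will do.
    obtain ⟨u, hu⟩ : ∃ u : I, (1 - 2 * (u : ℝ)) * (A w - B w) = t - s := by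
      rcases eq_or_ne (A w - B w) 0 with h0 | h0
      · refine ⟨0, ?_⟩
        rw [h0] at hm1 hm2
        rw [h0]
        linarith
      · have hpos : 0 < A w - B w := lt_of_le_of_ne (by linarith [abs_nonneg ((t : ℝ) - s)]) h0.symm
        have h3 : -1 ≤ ((t : ℝ) - s) / (A w - B w) := by rw [le_div_iff₀ hpos]; linarith
        have h4 : ((t : ℝ) - s) / (A w - B w) ≤ 1 := by rw [div_le_iff₀ hpos]; linarith
        refine ⟨⟨(1 - ((t : ℝ) - s) / (A w - B w)) / 2, by linarith, by linarith⟩, ?_⟩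
        simp only
        field_simp
        ring
    have hs := hAB w
    refine ⟨(u, w), Prod.ext (Subtype.ext ?_) (Subtype.ext ?_)⟩
    · rw [h1]
      simp only
      linarith
    · rw [h2]
      simp only
      linarith
  have hφ : IsQuotientMap φ := hφc.isClosedMap.isQuotientMap hφc hsurj
  have hfac : Function.FactorsThrough H.toContinuousMap (⟨φ, hφc⟩ : C(I × I, I × I)) := by
    rintro ⟨u, w⟩ ⟨u', w'⟩ h
    have e1 := (h1 (u, w)).symm.trans ((congrArg (fun z : I × I => (z.1 : ℝ)) h).trans (h1 (u', w')))
    have e2 := (h2 (u, w)).symm.trans ((congrArg (fun z : I × I => (z.2 : ℝ)) h).trans (h2 (u', w')))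
    simp only at e1 e2
    obtain rfl : w = w' := Subtype.ext (by linarith [hAB w, hAB w'])
    have e3 : ((u : ℝ) - u') * (A w - B w) = 0 := by linarith
    rcases mul_eq_zero.mp e3 with h | h
    · obtain rfl : u = u' := Subtype.ext (by linarith)
      rfl
    · have hw : w = 0 ∨ w = 1 := by
        have := hAB w
        rcases le_total (2 * (w : ℝ)) 1 with h' | h'
        · have : A w = 2 * w := min_eq_left h'
          exact Or.inl (Subtype.ext (by rw [Icc.coe_zero]; linarith))
        · have : A w = 1 := min_eq_right h'
          exact Or.inr (Subtype.ext (by rw [Icc.coe_one]; linarith))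
      change H (u, w) = H (u', w)
      rcases hw with rfl | rfl
      · rw [H.source, H.source]
      · rw [H.target, H.target]
  let k := IsQuotientMap.lift (f := (⟨φ, hφc⟩ : C(I × I, I × I))) hφ H.toContinuousMap hfac
  have hk : ∀ u w, k (φ (u, w)) = H (u, w) := fun u w =>
    DFunLike.congr_fun (IsQuotientMap.lift_comp (f := (⟨φ, hφc⟩ : C(I × I, I × I))) hφ
      H.toContinuousMap hfac) (u, w)
  have hH0 : ∀ w, H (0, w) = (p.trans q) w := fun w => H.apply_zero w
  have hH1 : ∀ w, H (1, w) = (r.trans s) w := fun w => H.apply_one w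
  have hlo : ∀ t : I, ∃ w : I, A w = t ∧ B w = 0 ∧
      ∀ {a b c : Y} (γ : Path a b) (δ : Path b c), (γ.trans δ) w = γ t := fun t => by
    refine ⟨⟨(t : ℝ) / 2, by linarith [t.2.1], by linarith [t.2.2]⟩, ?_, ?_, ?_⟩
    · simp only [A]; rw [min_eq_left (by linarith [t.2.2])]; ring
    · simp only [B]; rw [max_eq_right (by linarith [t.2.2])]
    · intro a b c γ δ
      rw [Path.trans_apply, dif_pos (by simp only; linarith [t.2.2])]
      congr 1
      exact Subtype.ext (by simp only; ring)
  have hhi : ∀ t : I, ∃ w : I, A w = 1 ∧ B w = t ∧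
      ∀ {a b c : Y} (γ : Path a b) (δ : Path b c), (γ.trans δ) w = δ t := fun t => by
    refine ⟨⟨((t : ℝ) + 1) / 2, by linarith [t.2.1], by linarith [t.2.2]⟩, ?_, ?_, ?_⟩
    · simp only [A]; rw [min_eq_right (by linarith [t.2.1])]
    · simp only [B]; rw [max_eq_left (by linarith [t.2.1])]; ring
    · intro a b c γ δ
      rw [Path.trans_apply]
      split_ifs with h
      · have ht : t = 0 := Subtype.ext (by
          simp only at h; rw [Icc.coe_zero]; linarith [t.2.1])
        subst ht
        rw [δ.source]
        refine Eq.trans ?_ γ.target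
        congr 1
        exact Subtype.ext (by simp)
      · congr 1
        exact Subtype.ext (by simp only; ring)
  refine ⟨k, fun t => ⟨?_, ?_, ?_, ?_⟩⟩
  · obtain ⟨w, hw1, hw2, hw3⟩ := hlo t
    have : φ (0, w) = (t, 0) := Prod.ext (Subtype.ext (by rw [h1]; simp [hw1])) (Subtype.ext
      (by rw [h2]; simp [hw2]))
    rw [← this, hk, hH0, hw3]
  · obtain ⟨w, hw1, hw2, hw3⟩ := hhi t
    have : φ (0, w) = (1, t) := Prod.ext (Subtype.ext (by rw [h1]; simp [hw1])) (Subtype.ext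
      (by rw [h2]; simp [hw2]))
    rw [← this, hk, hH0, hw3]
  · obtain ⟨w, hw1, hw2, hw3⟩ := hlo t
    have : φ (1, w) = (0, t) := Prod.ext (Subtype.ext (by rw [h1]; simp [hw2])) (Subtype.ext
      (by rw [h2]; simp [hw1]))
    rw [← this, hk, hH1, hw3]
  · obtain ⟨w, hw1, hw2, hw3⟩ := hhi t
    have : φ (1, w) = (t, 1) := Prod.ext (Subtype.ext (by rw [h1]; simp [hw2])) (Subtype.ext
      (by rw [h2]; simp [hw1]))
    rw [← this, hk, hH1, hw3]

end Square

section Quot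

variable {X Y : Type*} [TopologicalSpace X] [TopologicalSpace Y]

open Path.Homotopic.Quotient

theorem map_trans_class (f : C(X, Y)) {x y z : X} (γ : Path.Homotopic.Quotient x y)
    (δ : Path.Homotopic.Quotient y z) : (γ.trans δ).map f = (γ.map f).trans (δ.map f) := by
  obtain ⟨γ, rfl⟩ := mk_surjective γ
  obtain ⟨δ, rfl⟩ := mk_surjective δ
  rw [← mk_trans, ← mk_map, ← mk_map, ← mk_map, Path.map_trans, mk_trans]

theorem map_symm_class (f : C(X, Y)) {x y : X} (γ : Path.Homotopic.Quotient x y) :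
    γ.symm.map f = (γ.map f).symm := by
  obtain ⟨γ, rfl⟩ := mk_surjective γ
  rfl

theorem map_refl_class (f : C(X, Y)) (x : X) : (refl x).map f = refl (f x) := rfl

/-- The chosen paths are corrected by the inverse of the chosen loop at `x₀`, to make the one at
`x₀` trivial. -/
theorem exists_base_paths [PathConnectedSpace X] (x₀ : X) :
    ∃ w : ∀ x, Path.Homotopic.Quotient x₀ x, w x₀ = refl x₀ :=
  ⟨fun x => (mk (PathConnectedSpace.somePath x₀ x₀)).symm.trans
    (mk (PathConnectedSpace.somePath x₀ x)), Path.Homotopic.Quotient.symm_trans _⟩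

/-- A cast of a constant path class is the transition between propositionally equal points; this
moves it past another class. -/
theorem trans_cast_refl {a b y : Y} (h : b = y) (h' : a = y) (γ : Path.Homotopic.Quotient a b) :
    γ.trans ((refl y).cast h rfl) = ((refl y).cast h' rfl).trans (γ.cast h'.symm h.symm) := by
  subst h
  subst h'
  simp

/-- Multiplication in `FundamentalGroup` is concatenation in reverse order, hence the swapped
arguments of `map_mul`. -/
theorem hom_trans {x₀ : X} {y₀ : Y} (ψ : FundamentalGroup X x₀ →* FundamentalGroup Y y₀)
    (γ δ : Path.Homotopic.Quotient x₀ x₀) :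
    (ψ (γ.trans δ) : Path.Homotopic.Quotient y₀ y₀) =
      Path.Homotopic.Quotient.trans (ψ γ) (ψ δ) :=
  ψ.map_mul δ γ

theorem hom_refl {x₀ : X} {y₀ : Y} (ψ : FundamentalGroup X x₀ →* FundamentalGroup Y y₀) :
    (ψ (refl x₀) : Path.Homotopic.Quotient y₀ y₀) = refl y₀ :=
  ψ.map_one

end Quot

namespace IsEdgeSystem

variable {ι X Y : Type*} [TopologicalSpace X] [TopologicalSpace Y] {e : ι → C(I, X)}

open Path.Homotopic.Quotient

/-- Every homomorphism from the fundamental group of a graph is induced by a map. -/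
theorem exists_map_of_hom [Finite ι] [T2Space X] [ConnectedSpace X] (he : IsEdgeSystem e) {x₀ : X}
    (hx₀ : x₀ ∈ vertexSet e) {y₀ : Y} (ψ : FundamentalGroup X x₀ →* FundamentalGroup Y y₀) :
    ∃ (f : C(X, Y)) (h : f x₀ = y₀), FundamentalGroup.mapOfEq f h = ψ := by
  have := he.pathConnectedSpace
  obtain ⟨w, hw⟩ := exists_base_paths x₀
  -- `Ψ` extends `ψ` to the fundamental groupoid, closing up paths with the base paths `w`. The map
  -- `f` will send every vertex to `y₀` and every edge to a loop in its `Ψ`-class.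
  let Ψ : ∀ {x y : X}, Path.Homotopic.Quotient x y → Path.Homotopic.Quotient y₀ y₀ :=
    fun {x y} γ => ψ ((w x).trans (γ.trans (w y).symm))
  have hΨt : ∀ {x y z : X} (γ : Path.Homotopic.Quotient x y) (δ : Path.Homotopic.Quotient y z),
      Ψ (γ.trans δ) = (Ψ γ).trans (Ψ δ) := fun {x y z} γ δ => by
    simp only [Ψ]
    rw [← hom_trans]
    congr 1
    simp only [Path.Homotopic.Quotient.trans_assoc]
    rw [← Path.Homotopic.Quotient.trans_assoc (w y).symm, Path.Homotopic.Quotient.symm_trans,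
      Path.Homotopic.Quotient.refl_trans]
  have hΨr : ∀ x : X, Ψ (Path.Homotopic.Quotient.refl x) = Path.Homotopic.Quotient.refl y₀ := fun x => by
    simp only [Ψ]
    rw [Path.Homotopic.Quotient.refl_trans, Path.Homotopic.Quotient.trans_symm]
    exact hom_refl ψ
  have hΨ₀ : ∀ γ : Path.Homotopic.Quotient x₀ x₀, Ψ γ = ψ γ := fun γ => by
    simp only [Ψ, hw]
    congr 1
    have : (Path.Homotopic.Quotient.refl x₀).symm = Path.Homotopic.Quotient.refl x₀ := rfl
    rw [this, Path.Homotopic.Quotient.refl_trans, Path.Homotopic.Quotient.trans_refl]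
  choose l hl using fun i => mk_surjective (Ψ (segmentClass (e i) 0 1))
  have hlend : ∀ i s, s = 0 ∨ s = 1 → l i s = y₀ := by
    rintro i s (rfl | rfl)
    · exact (l i).source
    · exact (l i).target
  obtain ⟨f, hf⟩ := he.exists_glue (fun i => (l i).toContinuousMap) fun i j s t hs ht _ =>
    (hlend i s hs).trans (hlend j t ht).symm
  replace hf : ∀ i s, f (e i s) = l i s := hf
  have hfV : ∀ v ∈ vertexSet e, f v = y₀ := by
    rintro v ⟨i, rfl | rfl⟩
    · rw [hf, (l i).source]
    · rw [hf, (l i).target]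
  have h0 : ∀ i, f (e i 0) = y₀ := fun i => hfV _ ⟨i, Or.inl rfl⟩
  have h1 : ∀ i, f (e i 1) = y₀ := fun i => hfV _ ⟨i, Or.inr rfl⟩
  have hedge : ∀ i, ((segmentClass (e i) 0 1).map f).trans ((Path.Homotopic.Quotient.refl y₀).cast (h1 i) rfl) =
      ((Path.Homotopic.Quotient.refl y₀).cast (h0 i) rfl).trans (Ψ (segmentClass (e i) 0 1)) := fun i => by
    rw [trans_cast_refl (h1 i) (h0 i), ← hl i]
    congr 1
    refine congrArg mk ?_
    ext s
    simp [segment_apply, hf]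
  -- `η` is the natural transformation from `f_#` to `Ψ`: trivial at vertices, and at `e i s` it
  -- goes back along `f ∘ e i` to the start of the edge and then along `Ψ` of the initial segment.
  -- The second clause covers all presentations of `x` at once, so that `η` is well defined at
  -- vertices.
  have hη : ∀ x, ∃ η : Path.Homotopic.Quotient (f x) y₀,
      (∀ h : x ∈ vertexSet e, η = (Path.Homotopic.Quotient.refl y₀).cast (hfV x h) rfl) ∧
      ∀ i s (h : x = e i s), η = (((segmentClass (e i) s 0).map f).trans
        (((Path.Homotopic.Quotient.refl y₀).cast (h0 i) rfl).trans (Ψ (segmentClass (e i) 0 s)))).cast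
          (congrArg f h) rfl := by
    intro x
    by_cases hx : x ∈ vertexSet e
    · refine ⟨(Path.Homotopic.Quotient.refl y₀).cast (hfV x hx) rfl, fun _ => rfl, ?_⟩
      rintro i s rfl
      rw [cast_rfl_rfl]
      rcases he.apply_mem_vertexSet_iff.mp hx with rfl | rfl
      · rw [segmentClass_self, hΨr, map_refl_class, Path.Homotopic.Quotient.trans_refl,
          Path.Homotopic.Quotient.refl_trans]
      · rw [← hedge, ← Path.Homotopic.Quotient.trans_assoc, ← map_trans_class, segmentClass_trans,
          segmentClass_self, map_refl_class, Path.Homotopic.Quotient.refl_trans]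
    · obtain ⟨i, s, hs0, hs1, rfl⟩ := (he.mem_vertexSet_or x).resolve_left hx
      refine ⟨((segmentClass (e i) s 0).map f).trans
          (((Path.Homotopic.Quotient.refl y₀).cast (h0 i) rfl).trans (Ψ (segmentClass (e i) 0 s))),
        fun h => (hx h).elim, fun j t h => ?_⟩
      obtain ⟨rfl, rfl⟩ := he.inj hs0 hs1 h
      rw [cast_rfl_rfl]
  choose η hηV hηe using hη
  replace hηe : ∀ i s, η (e i s) = ((segmentClass (e i) s 0).map f).trans
        (((Path.Homotopic.Quotient.refl y₀).cast (h0 i) rfl).trans (Ψ (segmentClass (e i) 0 s))) := fun i s => by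
    rw [hηe _ i s rfl, cast_rfl_rfl]
  have key := he.path_induction (P := fun x y γ => (γ.map f).trans (η y) = (η x).trans (Ψ γ))
    (fun i s t => by
      rw [hηe, hηe, ← Path.Homotopic.Quotient.trans_assoc, ← map_trans_class, segmentClass_trans,
        Path.Homotopic.Quotient.trans_assoc, Path.Homotopic.Quotient.trans_assoc, ← hΨt,
        segmentClass_trans])
    (fun x y z γ δ hγ hδ => by
      rw [map_trans_class, hΨt, Path.Homotopic.Quotient.trans_assoc, hδ,
        ← Path.Homotopic.Quotient.trans_assoc, hγ, Path.Homotopic.Quotient.trans_assoc])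
  refine ⟨f, hfV x₀ hx₀, ?_⟩
  ext γ
  rw [FundamentalGroup.mapOfEq_apply]
  have := key x₀ x₀ γ
  rw [hηV x₀ hx₀, trans_cast_refl (hfV x₀ hx₀) (hfV x₀ hx₀), hΨ₀] at this
  have := congrArg (fun δ => Path.Homotopic.Quotient.trans
    ((Path.Homotopic.Quotient.refl y₀).cast (hfV x₀ hx₀) rfl).symm δ) this
  rwa [← Path.Homotopic.Quotient.trans_assoc, ← Path.Homotopic.Quotient.trans_assoc,
    Path.Homotopic.Quotient.symm_trans, Path.Homotopic.Quotient.refl_trans,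
    Path.Homotopic.Quotient.refl_trans] at this

/-- Based maps from a graph that agree on fundamental groups are homotopic. -/
theorem homotopicRel_of_mapOfEq_eq [Finite ι] [T2Space X] [ConnectedSpace X] (he : IsEdgeSystem e)
    {x₀ : X} (hx₀ : x₀ ∈ vertexSet e) {y₀ : Y} (f g : C(X, Y)) (hf : f x₀ = y₀) (hg : g x₀ = y₀)
    (h : FundamentalGroup.mapOfEq f hf = FundamentalGroup.mapOfEq g hg) :
    f.HomotopicRel g {x₀} := by
  have := he.pathConnectedSpace
  subst hf
  obtain ⟨w, hw⟩ := exists_base_paths x₀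
  let b : Path.Homotopic.Quotient (f x₀) (g x₀) := (Path.Homotopic.Quotient.refl (g x₀)).cast hg.symm rfl
  have hb : ∀ γ : Path.Homotopic.Quotient x₀ x₀, (γ.map f).trans b = b.trans (γ.map g) := by
    intro γ
    have := DFunLike.congr_fun h γ
    rw [FundamentalGroup.mapOfEq_apply, FundamentalGroup.mapOfEq_apply, cast_rfl_rfl] at this
    refine (trans_cast_refl hg.symm hg.symm _).trans ?_
    congr 1
    rw [this, Path.Homotopic.Quotient.cast_cast, cast_rfl_rfl]
  -- Conjugating by the base paths extends the identity `hb` at `x₀` to a natural transformation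
  -- from `f_#` to `g_#`.
  let c : ∀ x, Path.Homotopic.Quotient (f x) (g x) := fun x =>
    ((w x).map f).symm.trans (b.trans ((w x).map g))
  have hc : ∀ {x y : X} (γ : Path.Homotopic.Quotient x y),
      (γ.map f).trans (c y) = (c x).trans (γ.map g) := by
    intro x y γ
    have := hb ((w x).trans (γ.trans (w y).symm))
    simp only [map_trans_class, map_symm_class] at this
    have h2 : (c x).trans (γ.map g) = ((w x).map f).symm.trans ((b.trans (((w x).map g).trans
        ((γ.map g).trans ((w y).map g).symm))).trans ((w y).map g)) := by
      simp only [c, Path.Homotopic.Quotient.trans_assoc, Path.Homotopic.Quotient.symm_trans,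
        Path.Homotopic.Quotient.trans_refl]
    rw [h2, ← this]
    simp only [c, Path.Homotopic.Quotient.trans_assoc]
    rw [← Path.Homotopic.Quotient.trans_assoc ((w x).map f).symm,
      Path.Homotopic.Quotient.symm_trans, Path.Homotopic.Quotient.refl_trans]
  have hcx₀ : c x₀ = b := by
    simp only [c, hw, map_refl_class]
    have : (Path.Homotopic.Quotient.refl (f x₀)).symm = Path.Homotopic.Quotient.refl (f x₀) := rfl
    rw [this, Path.Homotopic.Quotient.refl_trans, Path.Homotopic.Quotient.trans_refl]
  -- Representatives of `c x` will be the tracks of the homotopy at the vertices; the one at `x₀` is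
  -- constant so that the homotopy is relative to `x₀`.
  have hp : ∀ x, ∃ p : Path (f x) (g x), mk p = c x ∧ (x = x₀ → ∀ t, p t = f x) := by
    intro x
    by_cases hx : x = x₀
    · subst hx
      exact ⟨(Path.refl (g x)).cast hg.symm rfl, hcx₀.symm, fun _ t => hg⟩
    · obtain ⟨p, hp⟩ := mk_surjective (c x)
      exact ⟨p, hp, fun h => (hx h).elim⟩
  choose p hp hp₀ using hp
  -- Naturality along an edge is the homotopy that fills the square over it.
  have hsq : ∀ i, ∃ k : C(I × I, Y), ∀ t, k (t, 0) = f (e i t) ∧ k (1, t) = p (e i 1) t ∧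
      k (0, t) = p (e i 0) t ∧ k (t, 1) = g (e i t) := by
    intro i
    obtain ⟨k, hk⟩ := exists_square_filling ((segment (e i) 0 1).map f.continuous) (p (e i 1))
      (p (e i 0)) ((segment (e i) 0 1).map g.continuous) (by
        rw [← Path.Homotopic.Quotient.eq, mk_trans, mk_trans, hp, hp]
        exact hc (segmentClass (e i) 0 1))
    refine ⟨k, fun t => ?_⟩
    have := hk t
    simpa [segment_apply] using this
  choose k hk using hsq
  have hkp : ∀ i s t, s = 0 ∨ s = 1 → k i (s, t) = p (e i s) t := by
    rintro i s t (rfl | rfl)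
    · exact (hk i t).2.2.1
    · exact (hk i t).2.1
  obtain ⟨K, hK⟩ := he.exists_glue_prod k fun i j s t z hs ht hst => by
    rw [hkp i s z hs, hkp j t z ht, hst]
  refine ⟨⟨⟨⟨fun x => K (x.2, x.1), by fun_prop⟩, fun x => ?_, fun x => ?_⟩, fun t x hx => ?_⟩⟩
  · obtain ⟨i, s, rfl⟩ := he.cover x
    exact (hK i s 0).trans (hk i s).1
  · obtain ⟨i, s, rfl⟩ := he.cover x
    exact (hK i s 1).trans (hk i s).2.2.2
  · obtain rfl : x = x₀ := hx
    obtain ⟨i, s, rfl⟩ := he.cover x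
    change K (e i s, t) = f (e i s)
    rw [hK, hkp i s t (he.apply_mem_vertexSet_iff.mp hx₀), hp₀ _ rfl]

end IsEdgeSystem

end GraphBU

/-! ### Subdivision and quotients by free involutions -/

namespace GraphBU

open scoped unitInterval
open Set

namespace IsEdgeSystem

variable {ι X : Type*} [TopologicalSpace X] {e : ι → C(I, X)}

/-- An edge can be subdivided at an interior point. -/
theorem exists_subdivision_point [Finite ι] (he : IsEdgeSystem e) (x : X) :
    ∃ (n : ℕ) (e' : Fin n → C(I, X)), IsEdgeSystem e' ∧ vertexSet e' = vertexSet e ∪ {x} := by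
  classical
  rcases he.mem_vertexSet_or x with hx | ⟨i₀, s₀, h0, h1, rfl⟩
  · obtain ⟨n, e', he', h⟩ := he.exists_fin
    exact ⟨n, e', he', by rw [h, union_eq_self_of_subset_right (singleton_subset_iff.mpr hx)]⟩
  have h0' : (0 : ℝ) < s₀ := unitInterval.pos_iff_ne_zero.mpr h0
  have h1' : (s₀ : ℝ) < 1 := unitInterval.lt_one_iff_ne_one.mpr h1
  -- The edge `i₀` is cut at `s₀`: `some i₀` covers the part below, `none` the part above, and the
  -- other edges are unchanged.
  let p : Option ι → ι := fun o => o.getD i₀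
  let φ : Option ι → C(I, I) := fun o => o.elim ⟨_, Icc.continuous_convexComb s₀ 1⟩
    fun j => if j = i₀ then ⟨_, Icc.continuous_convexComb 0 s₀⟩ else .id I
  have hφn : ∀ u, (φ none u : ℝ) = (1 - u) * s₀ + u := fun u => by
    change (((1 - u) * s₀ + u * (1 : I) : ℝ)) = _
    simp
  have hφi : ∀ u, (φ (some i₀) u : ℝ) = u * s₀ := fun u => by
    have : φ (some i₀) = ⟨_, Icc.continuous_convexComb 0 s₀⟩ := if_pos rfl
    rw [this]
    change (((1 - u) * (0 : I) + u * s₀ : ℝ)) = _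
    simp
  have hφj : ∀ j, j ≠ i₀ → ∀ u, φ (some j) u = u := fun j hj u => by
    have : φ (some j) = .id I := if_neg hj
    rw [this]
    rfl
  have hpos : ∀ {u : I}, u ≠ 0 → (0 : ℝ) < u := fun h => unitInterval.pos_iff_ne_zero.mpr h
  have hlt : ∀ {u : I}, u ≠ 1 → (u : ℝ) < 1 := fun h => unitInterval.lt_one_iff_ne_one.mpr h
  have hne : ∀ {u : I}, (0 : ℝ) < u → u ≠ 0 := fun h h' => by simp [h'] at h
  have hne1 : ∀ {u : I}, (u : ℝ) < 1 → u ≠ 1 := fun h h' => by simp [h'] at h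
  have hint : ∀ o u, u ≠ 0 → u ≠ 1 → φ o u ≠ 0 ∧ φ o u ≠ 1 := by
    intro o u hu0 hu1
    have := hpos hu0
    have := hlt hu1
    rcases o with _ | j
    · exact ⟨hne (by rw [hφn]; nlinarith), hne1 (by rw [hφn]; nlinarith)⟩
    · by_cases hj : j = i₀
      · subst hj
        exact ⟨hne (by rw [hφi]; nlinarith), hne1 (by rw [hφi]; nlinarith)⟩
      · rw [hφj j hj]
        exact ⟨hu0, hu1⟩
  have hsys : IsEdgeSystem (fun o => (e (p o)).comp (φ o)) := by
    refine ⟨fun x => ?_, fun {o o' u u'} hu0 hu1 h => ?_⟩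
    · obtain ⟨i, s, rfl⟩ := he.cover x
      by_cases hi : i = i₀
      · subst hi
        rcases le_total (s : ℝ) s₀ with h | h
        · refine ⟨some i, ⟨s / s₀, div_nonneg s.2.1 h0'.le, (div_le_one h0').mpr h⟩, ?_⟩
          change e i _ = _
          congr 1
          refine Subtype.ext ((hφi _).trans ?_)
          simp only
          field_simp
        · refine ⟨none, ⟨(s - s₀) / (1 - s₀), div_nonneg (by linarith) (by linarith),
            (div_le_one (by linarith)).mpr (by linarith [s.2.2])⟩, ?_⟩
          change e i _ = _
          congr 1
          refine Subtype.ext ((hφn _).trans ?_)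
          have : (1 : ℝ) - s₀ ≠ 0 := by linarith
          simp only
          field_simp
          ring
      · exact ⟨some i, s, congrArg (e i) (hφj i hi s)⟩
    · have := hpos hu0
      have := hlt hu1
      obtain ⟨h2, h3⟩ := he.inj (hint o u hu0 hu1).1 (hint o u hu0 hu1).2 h
      have h4 : (φ o u : ℝ) = φ o' u' := congrArg Subtype.val h3
      have := u'.2.1
      have := u'.2.2
      rcases o with _ | j <;> rcases o' with _ | j'
      · rw [hφn, hφn] at h4
        refine ⟨rfl, Subtype.ext ?_⟩
        have : (1 - s₀ : ℝ) * (u - u') = 0 := by linarith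
        rcases mul_eq_zero.mp this with h | h <;> linarith
      · obtain rfl : i₀ = j' := h2
        rw [hφn, hφi] at h4
        nlinarith
      · obtain rfl : j = i₀ := h2
        rw [hφn, hφi] at h4
        nlinarith
      · obtain rfl : j = j' := h2
        by_cases hj : j = i₀
        · subst hj
          rw [hφi, hφi] at h4
          exact ⟨rfl, Subtype.ext (mul_right_cancel₀ h0'.ne' h4)⟩
        · rw [hφj j hj, hφj j hj] at h3
          exact ⟨rfl, h3⟩
  obtain ⟨n, e', he', hvert⟩ := hsys.exists_fin
  refine ⟨n, e', he', hvert.trans ?_⟩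
  have hn0 : φ none 0 = s₀ := Subtype.ext (by rw [hφn]; simp)
  have hn1 : φ none 1 = 1 := Subtype.ext (by rw [hφn]; simp)
  have hi0 : φ (some i₀) 0 = 0 := Subtype.ext (by rw [hφi]; simp)
  have hi1 : φ (some i₀) 1 = s₀ := Subtype.ext (by rw [hφi]; simp)
  ext x
  constructor
  · rintro ⟨o, h⟩
    change x = e (p o) (φ o 0) ∨ x = e (p o) (φ o 1) at h
    rcases o with _ | j
    · rw [hn0, hn1] at h
      exact h.elim Or.inr fun h => Or.inl ⟨i₀, Or.inr h⟩
    · by_cases hj : j = i₀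
      · subst hj
        rw [hi0, hi1] at h
        exact h.elim (fun h => Or.inl ⟨j, Or.inl h⟩) Or.inr
      · rw [hφj j hj, hφj j hj] at h
        exact Or.inl ⟨j, h⟩
  · rintro (⟨j, h⟩ | h)
    · by_cases hj : j = i₀
      · subst hj
        rcases h with h | h
        · refine ⟨some j, Or.inl ?_⟩
          change x = e j (φ (some j) 0)
          rw [hi0, h]
        · refine ⟨none, Or.inr ?_⟩
          change x = e j (φ none 1)
          rw [hn1, h]
      · refine ⟨some j, ?_⟩
        change x = e j (φ (some j) 0) ∨ x = e j (φ (some j) 1)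
        rwa [hφj j hj, hφj j hj]
    · refine ⟨none, Or.inl ?_⟩
      change x = e i₀ (φ none 0)
      rw [hn0]
      exact h

theorem exists_subdivision {n : ℕ} {e : Fin n → C(I, X)} (he : IsEdgeSystem e) {S : Set X}
    (hS : S.Finite) :
    ∃ (m : ℕ) (e' : Fin m → C(I, X)), IsEdgeSystem e' ∧ vertexSet e' = vertexSet e ∪ S := by
  induction S, hS using Set.Finite.induction_on with
  | empty => exact ⟨n, e, he, by simp⟩
  | @insert x S _ _ ih =>
    obtain ⟨m, e', he', h⟩ := ih
    obtain ⟨k, e'', he'', h'⟩ := he'.exists_subdivision_point x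
    exact ⟨k, e'', he'', by rw [h', h, insert_eq, union_comm {x}, union_assoc]⟩

end IsEdgeSystem

namespace FreeInvolution

variable {X : Type*} [TopologicalSpace X] (τ : FreeInvolution X)

theorem proj_surjective : Function.Surjective τ.proj := Quotient.mk_surjective

theorem proj_eq_iff {x y : X} : τ.proj x = τ.proj y ↔ x = y ∨ x = τ.toMap y :=
  Quotient.eq (r := τ.setoid)

theorem proj_toMap (x : X) : τ.proj (τ.toMap x) = τ.proj x := τ.proj_eq_iff.mpr (Or.inr rfl)

instance [ConnectedSpace X] : ConnectedSpace τ.Orbit :=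
  τ.proj_surjective.connectedSpace τ.proj.continuous

theorem isOpenMap_proj : IsOpenMap τ.proj := by
  intro U hU
  have : τ.proj ⁻¹' (τ.proj '' U) = U ∪ τ.toMap ⁻¹' U := by
    ext x
    constructor
    · rintro ⟨y, hy, h⟩
      rcases τ.proj_eq_iff.mp h with rfl | rfl
      · exact Or.inl hy
      · exact Or.inr hy
    · rintro (h | h)
      · exact ⟨x, h, rfl⟩
      · exact ⟨_, h, τ.proj_toMap x⟩
  have hq : IsQuotientMap τ.proj := isQuotientMap_quotient_mk' (s := τ.setoid)
  rw [← hq.isOpen_preimage, this]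
  exact hU.union (hU.preimage τ.toMap.continuous)

instance [T2Space X] : T2Space τ.Orbit := by
  refine ⟨fun a b hab => ?_⟩
  obtain ⟨x, rfl⟩ := τ.proj_surjective a
  obtain ⟨y, rfl⟩ := τ.proj_surjective b
  have h := (not_congr τ.proj_eq_iff).mp hab
  push Not at h
  obtain ⟨U, V, hU, hV, hxU, hyV, hUV⟩ := t2_separation h.1
  obtain ⟨U', V', hU', hV', hxU', hyV', hUV'⟩ := t2_separation h.2
  refine ⟨τ.proj '' (U ∩ U'), τ.proj '' (V ∩ τ.toMap ⁻¹' V'),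
    τ.isOpenMap_proj _ (hU.inter hU'),
    τ.isOpenMap_proj _ (hV.inter (hV'.preimage τ.toMap.continuous)),
    ⟨x, ⟨hxU, hxU'⟩, rfl⟩, ⟨y, ⟨hyV, hyV'⟩, rfl⟩, ?_⟩
  rw [Set.disjoint_left]
  rintro _ ⟨p, ⟨hp, hp'⟩, rfl⟩ ⟨q, ⟨hq, hq'⟩, h⟩
  rcases τ.proj_eq_iff.mp h.symm with rfl | rfl
  · exact Set.disjoint_left.mp hUV hp hq
  · exact Set.disjoint_left.mp hUV' hp' hq'

end FreeInvolution

theorem setOf_interior_eq : {s : I | s ≠ 0 ∧ s ≠ 1} = Ioo 0 1 := by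
  ext s
  exact and_congr unitInterval.pos_iff_ne_zero.symm unitInterval.lt_one_iff_ne_one.symm

namespace IsEdgeSystem

variable {ι X : Type*} [TopologicalSpace X] {e : ι → C(I, X)}

/-- The involution preserves the complement of the vertices, and the image of an open edge is
connected; it therefore stays in one of the disjoint open edges. -/
theorem exists_image_openEdge [Finite ι] [T2Space X] (he : IsEdgeSystem e) (τ : FreeInvolution X)
    (hV : ∀ x ∈ vertexSet e, τ.toMap x ∈ vertexSet e) (i : ι) :
    ∃ j, ∀ s, s ≠ 0 → s ≠ 1 → ∃ t, t ≠ 0 ∧ t ≠ 1 ∧ e j t = τ.toMap (e i s) := by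
  have hint : ∀ s, s ≠ 0 → s ≠ 1 → ∃ j t, t ≠ 0 ∧ t ≠ 1 ∧ e j t = τ.toMap (e i s) := by
    intro s h0 h1
    refine (he.mem_vertexSet_or _).resolve_left fun h => ?_
    have := hV _ h
    rw [τ.involutive] at this
    exact he.apply_notMem_vertexSet h0 h1 this
  obtain ⟨s₀, hs₀⟩ : (Ioo (0 : I) 1).Nonempty := nonempty_Ioo.mpr zero_lt_one
  rw [← setOf_interior_eq] at hs₀
  obtain ⟨j, hj⟩ := hint s₀ hs₀.1 hs₀.2
  refine ⟨j, ?_⟩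
  let U : ι → Set X := fun i => {x | ∃ s, s ≠ 0 ∧ s ≠ 1 ∧ e i s = x}
  have hsub := IsPreconnected.subset_left_of_subset_union (he.isOpen_openEdge j)
    (v := ⋃ k ∈ {k | k ≠ j}, U k)
    (isOpen_biUnion fun k _ => he.isOpen_openEdge k) (by
      rw [Set.disjoint_left]
      rintro _ ⟨s, h0, h1, rfl⟩ h
      simp only [mem_iUnion] at h
      obtain ⟨k, hk, t, ht0, ht1, h⟩ := h
      exact hk (he.inj ht0 ht1 h).1)
    (s := (fun s => τ.toMap (e i s)) '' Ioo 0 1) (by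
      rintro _ ⟨s, hs, rfl⟩
      rw [← setOf_interior_eq] at hs
      obtain ⟨k, hk⟩ := hint s hs.1 hs.2
      by_cases hkj : k = j
      · subst hkj
        exact Or.inl hk
      · exact Or.inr (mem_biUnion (x := k) hkj hk))
    ⟨_, ⟨s₀, setOf_interior_eq ▸ hs₀, rfl⟩, hj⟩
    (isPreconnected_Ioo.image _ (by fun_prop))
  intro s h0 h1
  exact hsub ⟨s, setOf_interior_eq ▸ (⟨h0, h1⟩ : s ∈ {s : I | s ≠ 0 ∧ s ≠ 1}), rfl⟩

/-- An involution `g` of an open interval has a fixed point: `g s - s` takes opposite signs at `a`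
and `g a`, so the intermediate value theorem applies. -/
theorem not_image_openEdge_self [T2Space X] (he : IsEdgeSystem e)
    (τ : FreeInvolution X) (i : ι) :
    ¬ ∀ s, s ≠ 0 → s ≠ 1 → ∃ t, t ≠ 0 ∧ t ≠ 1 ∧ e i t = τ.toMap (e i s) := by
  intro h
  obtain ⟨g, hg⟩ := he.exists_lift_edge i (fun s : Ioo (0 : I) 1 => τ.toMap (e i s)) (by fun_prop)
    fun s => h s (ne_of_gt s.2.1) (ne_of_lt s.2.2)
  have hmem : ∀ s, g s ∈ Ioo (0 : I) 1 := fun s => by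
    have : g s ∈ {s : I | s ≠ 0 ∧ s ≠ 1} := ⟨(hg s).1, (hg s).2.1⟩
    rwa [setOf_interior_eq] at this
  have hinv : ∀ s, g ⟨g s, hmem s⟩ = s := by
    intro s
    refine (he.inj (i := i) (j := i) (hg _).1 (hg _).2.1 ?_).2
    rw [(hg _).2.2]
    simp only
    rw [(hg s).2.2, τ.involutive]
  have : PreconnectedSpace (Ioo (0 : I) 1) :=
    isPreconnected_iff_preconnectedSpace.mp isPreconnected_Ioo
  obtain ⟨a⟩ : Nonempty (Ioo (0 : I) 1) := (nonempty_Ioo.mpr zero_lt_one).to_subtype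
  have hfix : ∃ s, g s = s := by
    rcases le_total (g a) a with h | h
    · exact intermediate_value_univ₂ (a := a) (b := ⟨g a, hmem a⟩) g.continuous
        continuous_subtype_val h (by rw [hinv]; exact h)
    · exact intermediate_value_univ₂ (a := ⟨g a, hmem a⟩) (b := a) g.continuous
        continuous_subtype_val (by rw [hinv]; exact h) h
  obtain ⟨s, hs⟩ := hfix
  have := (hg s).2.2
  rw [hs] at this
  exact τ.free _ this.symm

/-- The quotient of a graph by a free involution that preserves the vertices is a graph. -/
theorem exists_orbit_isEdgeSystem {n : ℕ} {e : Fin n → C(I, X)} [T2Space X] (he : IsEdgeSystem e)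
    (τ : FreeInvolution X) (hV : ∀ x ∈ vertexSet e, τ.toMap x ∈ vertexSet e) :
    ∃ (m : ℕ) (e' : Fin m → C(I, τ.Orbit)), IsEdgeSystem e' ∧
      τ.proj '' vertexSet e ⊆ vertexSet e' := by
  choose r hr using he.exists_image_openEdge τ hV
  obtain ⟨s₀, hs₀⟩ : (Ioo (0 : I) 1).Nonempty := nonempty_Ioo.mpr zero_lt_one
  have hs₀' := hs₀
  rw [← setOf_interior_eq] at hs₀
  have hrr : ∀ i, r (r i) = i := by
    intro i
    obtain ⟨t, h0, h1, h⟩ := hr i s₀ hs₀.1 hs₀.2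
    obtain ⟨u, hu0, hu1, h'⟩ := hr (r i) t h0 h1
    rw [h, τ.involutive] at h'
    exact (he.inj hu0 hu1 h').1
  have hri : ∀ i, r i ≠ i := fun i hi => by
    have := hr i
    rw [hi] at this
    exact he.not_image_openEdge_self τ i this
  -- The inclusion known on the open edge extends to its endpoints by taking closures.
  have hrange : ∀ i s, τ.toMap (e i s) ∈ range (e (r i)) := by
    intro i s
    have hcl : IsClosed {s | τ.toMap (e i s) ∈ range (e (r i))} :=
      (isClosed_range (e (r i))).preimage (by fun_prop : Continuous fun s => τ.toMap (e i s))
    have hsub : Ioo (0 : I) 1 ⊆ {s | τ.toMap (e i s) ∈ range (e (r i))} := by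
      intro s hs
      rw [← setOf_interior_eq] at hs
      obtain ⟨t, -, -, h⟩ := hr i s hs.1 hs.2
      exact ⟨t, h⟩
    have := closure_minimal hsub hcl
    rw [closure_Ioo zero_ne_one] at this
    exact this ⟨s.2.1, s.2.2⟩
  -- Since `r` is an involution without fixed points, the condition `i < r i` selects one edge from
  -- each orbit.
  have hsys : IsEdgeSystem (fun i : {i // i < r i} => τ.proj.comp (e i)) := by
    refine ⟨fun q => ?_, ?_⟩
    · obtain ⟨x, rfl⟩ := τ.proj_surjective q
      obtain ⟨i, s, rfl⟩ := he.cover x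
      rcases (hri i).lt_or_gt with h | h
      · obtain ⟨t, ht⟩ := hrange i s
        refine ⟨⟨r i, by rwa [hrr]⟩, t, ?_⟩
        change τ.proj (e (r i) t) = _
        rw [ht, τ.proj_toMap]
      · exact ⟨⟨i, h⟩, s, rfl⟩
    · rintro ⟨i, hi⟩ ⟨j, hj⟩ s t h0 h1 h
      rcases τ.proj_eq_iff.mp h with h | h
      · obtain ⟨rfl, rfl⟩ := he.inj h0 h1 h
        exact ⟨rfl, rfl⟩
      · obtain ⟨u, hu⟩ := hrange j t
        obtain ⟨rfl, -⟩ := he.inj h0 h1 (h.trans hu.symm)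
        rw [hrr] at hi
        exact absurd hi hj.not_gt
  obtain ⟨m, e', he', h'⟩ := hsys.exists_fin
  refine ⟨m, e', he', ?_⟩
  rw [h']
  rintro _ ⟨x, hx, rfl⟩
  obtain ⟨i, s, rfl⟩ := he.cover x
  rcases (hri i).lt_or_gt with h | h
  · obtain ⟨t, ht⟩ := hrange i s
    have := hV _ hx
    rw [← ht, he.apply_mem_vertexSet_iff] at this
    rw [← τ.proj_toMap, ← ht]
    refine ⟨⟨r i, by rwa [hrr]⟩, ?_⟩
    rcases this with rfl | rfl
    · exact Or.inl rfl
    · exact Or.inr rfl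
  · refine ⟨⟨i, h⟩, ?_⟩
    rcases he.apply_mem_vertexSet_iff.mp hx with rfl | rfl
    · exact Or.inl rfl
    · exact Or.inr rfl

end IsEdgeSystem

end GraphBU

/-! ### Sliding a second particle around a first one -/

namespace GraphBU

open scoped unitInterval
open Set

section Slide

variable {X : Type*} [TopologicalSpace X]

theorem path_trans_ne {a b c a' b' c' : X} {p : Path a b} {q : Path b c} {p' : Path a' b'}
    {q' : Path b' c'} (h : ∀ t, p t ≠ p' t) (h' : ∀ t, q t ≠ q' t) (t : I) :
    (p.trans q) t ≠ (p'.trans q') t := by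
  rw [Path.trans_apply, Path.trans_apply]
  split_ifs
  · exact h _
  · exact h' _

/-- A second particle can be moved from `y` to `y'` while the first one performs a null-homotopic
loop at `x`, without collisions. -/
def Slides (x y y' : X) : Prop :=
  ∃ (p : Path x x) (q : Path y y'), (∀ t, p t ≠ q t) ∧ p.Homotopic (Path.refl x)

/-- Any two positions of a second particle are related by sliding around `x`. -/
def IsSlidable (x : X) : Prop := ∀ y y', y ≠ x → y' ≠ x → Slides x y y'

theorem Slides.symm {x y y' : X} (h : Slides x y y') : Slides x y' y := by
  obtain ⟨p, q, h, hp⟩ := h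
  exact ⟨p.symm, q.symm, fun t => h _, hp.symm₂⟩

theorem Slides.trans {x y y' y'' : X} (h : Slides x y y') (h' : Slides x y' y'') :
    Slides x y y'' := by
  obtain ⟨p, q, h, hp⟩ := h
  obtain ⟨p', q', h', hp'⟩ := h'
  exact ⟨p.trans p', q.trans q', path_trans_ne h h',
    (hp.hcomp hp').trans ⟨Path.Homotopy.reflTrans _⟩⟩

theorem Slides.of_joinedIn {x y y' : X} (h : JoinedIn {x}ᶜ y y') : Slides x y y' := by
  obtain ⟨q, hq⟩ := h
  exact ⟨Path.refl x, q, fun t h => hq t h.symm, .refl _⟩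

/-- The first particle goes along `δ` while the second waits at `y`, the slide takes place at `x'`,
and the first particle returns while the second waits at `y'`. A conjugate of a null-homotopic loop
is null-homotopic. -/
theorem Slides.of_path {x x' y y' : X} (δ : Path x x') (hy : ∀ t, δ t ≠ y) (hy' : ∀ t, δ t ≠ y')
    (h : Slides x' y y') : Slides x y y' := by
  obtain ⟨p, q, h, hp⟩ := h
  refine ⟨δ.trans (p.trans δ.symm), (Path.refl y).trans (q.trans (Path.refl y')),
    path_trans_ne hy (path_trans_ne h fun t => hy' _), ?_⟩
  have h1 : (p.trans δ.symm).Homotopic δ.symm :=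
    (hp.hcomp (.refl _)).trans ⟨Path.Homotopy.reflTrans _⟩
  exact ((Path.Homotopic.refl δ).hcomp h1).trans ⟨(Path.Homotopy.reflTransSymm δ).symm⟩

/-- Hypothesis `H` lets the second particle clear the route `δ` before the first one sets out. -/
theorem IsSlidable.of_path {x x' : X} (δ : Path x x')
    (H : ∀ y, y ≠ x → ∃ z, (∀ t, δ t ≠ z) ∧ JoinedIn {x}ᶜ y z) (h : IsSlidable x') :
    IsSlidable x := by
  intro y y' hy hy'
  obtain ⟨z, hz, hyz⟩ := H y hy
  obtain ⟨z', hz', hyz'⟩ := H y' hy'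
  refine (Slides.of_joinedIn hyz).trans (.trans ?_ (Slides.of_joinedIn hyz').symm)
  refine Slides.of_path δ hz hz' (h z z' ?_ ?_)
  · rintro rfl
    exact hz 1 δ.target
  · rintro rfl
    exact hz' 1 δ.target

theorem joinedIn_segment {F : Set X} (f : C(I, X)) {s t : I} (h : s ≤ t)
    (hF : ∀ v, s ≤ v → v ≤ t → f v ∈ F) : JoinedIn F (f s) (f t) :=
  ⟨segment f s t, fun _ => hF _ (Icc.le_convexComb h _) (Icc.convexComb_le h _)⟩

end Slide

section Dart

variable {ι X : Type*} [TopologicalSpace X]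

/-- The edges together with their reversals. -/
def dart (e : ι → C(I, X)) (d : ι × Bool) : C(I, X) :=
  if d.2 then (e d.1).comp ⟨unitInterval.symm, unitInterval.continuous_symm⟩ else e d.1

/-- The reversed edge. -/
def dartRev (d : ι × Bool) : ι × Bool := (d.1, !d.2)

variable (e : ι → C(I, X))

theorem dart_false (i : ι) (s : I) : dart e (i, false) s = e i s := rfl

theorem dart_true (i : ι) (s : I) : dart e (i, true) s = e i (unitInterval.symm s) := rfl

theorem dart_rev (d : ι × Bool) (s : I) : dart e (dartRev d) s = dart e d (unitInterval.symm s) := by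
  obtain ⟨i, b⟩ := d
  cases b
  · rfl
  · change e i s = e i (unitInterval.symm (unitInterval.symm s))
    rw [unitInterval.symm_symm]

theorem dart_rev_zero (d : ι × Bool) : dart e (dartRev d) 0 = dart e d 1 := by
  rw [dart_rev, unitInterval.symm_zero]

theorem dart_mem_range (d : ι × Bool) (s : I) : ∃ t, dart e d s = e d.1 t := by
  obtain ⟨i, b⟩ := d
  cases b
  · exact ⟨s, rfl⟩
  · exact ⟨unitInterval.symm s, rfl⟩

theorem mem_vertexSet_iff_dart {x : X} : x ∈ vertexSet e ↔ ∃ d, dart e d 0 = x := by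
  constructor
  · rintro ⟨i, rfl | rfl⟩
    · exact ⟨(i, false), rfl⟩
    · exact ⟨(i, true), by rw [dart_true, unitInterval.symm_zero]⟩
  · rintro ⟨⟨i, b⟩, rfl⟩
    cases b
    · exact ⟨i, Or.inl rfl⟩
    · exact ⟨i, Or.inr (by rw [dart_true, unitInterval.symm_zero])⟩

end Dart

theorem symm_interior {s : I} (h0 : s ≠ 0) (h1 : s ≠ 1) :
    unitInterval.symm s ≠ 0 ∧ unitInterval.symm s ≠ 1 := by
  constructor
  · intro h
    rw [unitInterval.symm_eq_zero] at h
    exact h1 h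
  · intro h
    rw [unitInterval.symm_eq_one] at h
    exact h0 h

/-- The parameter `1 / 3`. -/
noncomputable def third : I := ⟨1 / 3, by norm_num, by norm_num⟩

theorem coe_third : (third : ℝ) = 1 / 3 := rfl

theorem third_ne_zero : third ≠ 0 := fun h => by
  have := congrArg Subtype.val h
  rw [coe_third] at this
  norm_num at this

theorem third_ne_one : third ≠ 1 := fun h => by
  have := congrArg Subtype.val h
  rw [coe_third] at this
  norm_num at this

namespace IsEdgeSystem

variable {ι X : Type*} [TopologicalSpace X] {e : ι → C(I, X)}

theorem dart_inj (he : IsEdgeSystem e) {d d' : ι × Bool} {s t : I} (h0 : s ≠ 0) (h1 : s ≠ 1)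
    (h : dart e d s = dart e d' t) :
    (d = d' ∧ s = t) ∨ (d' = dartRev d ∧ t = unitInterval.symm s) := by
  obtain ⟨i, b⟩ := d
  obtain ⟨j, b'⟩ := d'
  cases b <;> cases b'
  · obtain ⟨rfl, rfl⟩ := he.inj h0 h1 h
    exact Or.inl ⟨rfl, rfl⟩
  · obtain ⟨rfl, rfl⟩ := he.inj h0 h1 h
    exact Or.inr ⟨rfl, by simp⟩
  · obtain ⟨rfl, rfl⟩ := he.inj (symm_interior h0 h1).1 (symm_interior h0 h1).2 h
    exact Or.inr ⟨rfl, rfl⟩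
  · obtain ⟨rfl, h'⟩ := he.inj (symm_interior h0 h1).1 (symm_interior h0 h1).2 h
    exact Or.inl ⟨rfl, unitInterval.symm_inj.mp h'⟩

theorem dart_inj_self (he : IsEdgeSystem e) {d : ι × Bool} {s t : I} (h0 : s ≠ 0) (h1 : s ≠ 1)
    (h : dart e d s = dart e d t) : s = t := by
  rcases he.dart_inj h0 h1 h with h | h
  · exact h.2
  · have := congrArg Prod.snd h.1
    simp [dartRev] at this

theorem dart_ne_vertex (he : IsEdgeSystem e) {d d' : ι × Bool} {s : I} (h0 : s ≠ 0) (h1 : s ≠ 1) :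
    dart e d s ≠ dart e d' 0 := by
  intro h
  rcases he.dart_inj h0 h1 h with h | h
  · exact h0 h.2
  · exact (symm_interior h0 h1).1 h.2.symm

/-- The first particle moves forward along the dart to `s`. If the second one is on that stretch, it
is pushed ahead to some `u'` strictly between `s` and `1`. -/
theorem isSlidable_start (he : IsEdgeSystem e) {d : ι × Bool} {s : I} (h1 : s ≠ 1)
    (h : IsSlidable (dart e d s)) : IsSlidable (dart e d 0) := by
  refine IsSlidable.of_path (segment (dart e d) 0 s) (fun y hy => ?_) h
  by_cases hyd : ∃ u, u ≤ s ∧ dart e d u = y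
  · obtain ⟨u, hu, rfl⟩ := hyd
    have hu0 : u ≠ 0 := by rintro rfl; exact hy rfl
    obtain ⟨u', hu', hu1⟩ := exists_between (unitInterval.lt_one_iff_ne_one.mpr h1)
    refine ⟨dart e d u', fun t ht => ?_, joinedIn_segment _ (hu.trans hu'.le) fun v hv hv' => ?_⟩
    · obtain ⟨v, ⟨-, hv⟩, hvt⟩ := range_segment_subset (dart e d) (unitInterval.nonneg' (t := s)) (u := t)
      have hu'0 : u' ≠ 0 := fun h => by
        rw [h] at hu'
        exact absurd hu' (not_lt.mpr unitInterval.nonneg')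
      have := he.dart_inj_self hu'0 hu1.ne (ht.symm.trans hvt)
      exact absurd hv (not_le.mpr (this ▸ hu'))
    · refine he.dart_ne_vertex ?_ (hv'.trans_lt hu1).ne
      exact (lt_of_lt_of_le (unitInterval.pos_iff_ne_zero.mpr hu0) hv).ne'
  · refine ⟨y, fun t ht => ?_, JoinedIn.refl hy⟩
    obtain ⟨v, ⟨-, hv⟩, hvt⟩ := range_segment_subset (dart e d) (unitInterval.nonneg' (t := s)) (u := t)
    exact hyd ⟨v, hv, hvt ▸ ht⟩

/-- The first particle retreats to the start of the dart. If the second one is in its way, it is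
pushed through the start vertex onto the other dart `d'`. -/
theorem isSlidable_of_start (he : IsEdgeSystem e) {d d' : ι × Bool} (hdd : d ≠ d')
    (hd : dart e d' 0 = dart e d 0) {s : I} (h0 : s ≠ 0) (h1 : s ≠ 1)
    (h : IsSlidable (dart e d 0)) : IsSlidable (dart e d s) := by
  refine IsSlidable.of_path (segment (dart e d) 0 s).symm (fun y hy => ?_) h
  by_cases hyd : ∃ u, u ≤ s ∧ dart e d u = y
  · obtain ⟨u, hu, rfl⟩ := hyd
    have hus : u < s := lt_of_le_of_ne hu fun h => hy (by rw [h])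
    have hs1 : (s : ℝ) < 1 := unitInterval.lt_one_iff_ne_one.mpr h1
    have hs0 : (0 : ℝ) < s := unitInterval.pos_iff_ne_zero.mpr h0
    -- If `d'` is the reversal of `d`, the parameter `ε` on `d'` is `1 - ε` on `d`. The choice makes
    -- `1 - ε = (1 + s) / 2 > s`, beyond the stretch in use.
    let ε : I := ⟨(1 - s) / 2, by linarith, by linarith⟩
    have hε : (ε : ℝ) = (1 - s) / 2 := rfl
    have hε0 : ε ≠ 0 := fun h => by
      have := congrArg Subtype.val h
      rw [hε] at this
      simp only [Icc.coe_zero] at this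
      linarith
    have hε1 : ε ≠ 1 := fun h => by
      have := congrArg Subtype.val h
      rw [hε] at this
      simp only [Icc.coe_one] at this
      linarith
    refine ⟨dart e d' ε, fun t ht => ?_, ?_⟩
    · obtain ⟨v, ⟨-, hv⟩, hvt⟩ := range_segment_subset (dart e d)
        (unitInterval.nonneg' (t := s)) (u := unitInterval.symm t)
      rcases he.dart_inj hε0 hε1 (ht.symm.trans hvt) with h | h
      · exact hdd h.1.symm
      · have hv' : (v : ℝ) ≤ s := hv
        have := congrArg Subtype.val h.2
        rw [unitInterval.coe_symm_eq, hε] at this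
        linarith
    · refine (joinedIn_segment (F := {dart e d s}ᶜ) (t := u) (dart e d) unitInterval.nonneg'
        fun v _ hv h => ?_).symm.trans ?_
      · exact (hv.trans_lt hus).ne' (he.dart_inj_self h0 h1 h.symm)
      · rw [← hd]
        refine joinedIn_segment (dart e d') unitInterval.nonneg' fun v _ hv h => ?_
        rcases he.dart_inj h0 h1 h.symm with h | h
        · exact hdd h.1
        · have hv' : (v : ℝ) ≤ ε := hv
          have := congrArg Subtype.val h.2
          rw [unitInterval.coe_symm_eq] at this
          linarith
  · refine ⟨y, fun t ht => ?_, JoinedIn.refl hy⟩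
    obtain ⟨v, ⟨-, hv⟩, hvt⟩ := range_segment_subset (dart e d)
      (unitInterval.nonneg' (t := s)) (u := unitInterval.symm t)
    exact hyd ⟨v, hv, hvt ▸ ht⟩

theorem exists_dart_of_apply {i : ι} {t : I} {x : X} (ht : t = 0 ∨ t = 1) (h : e i t = x) :
    ∃ d : ι × Bool, d.1 = i ∧ dart e d 0 = x := by
  rcases ht with rfl | rfl
  · exact ⟨(i, false), rfl, h⟩
  · exact ⟨(i, true), rfl, by rw [dart_true, unitInterval.symm_zero, h]⟩

/-- Every point of a graph other than the vertex `x` can be moved in the complement of `x` to an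
edge that starts at `x`. -/
theorem exists_joinedIn_dart [Finite ι] [T2Space X] [PreconnectedSpace X] (he : IsEdgeSystem e)
    {x : X} (hx : x ∈ vertexSet e) {y : X} (hy : y ≠ x) :
    ∃ d, dart e d 0 = x ∧ JoinedIn {x}ᶜ y (dart e d third) := by
  have hA : ∀ d : ι × Bool, dart e d 0 = x → ∀ t, e d.1 t ≠ x →
      ∃ a, dart e a 0 = x ∧ JoinedIn {x}ᶜ (e d.1 t) (dart e a third) := by
    rintro d rfl t ht
    refine ⟨d, rfl, ?_⟩
    obtain ⟨u, hu⟩ : ∃ u, dart e d u = e d.1 t := by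
      obtain ⟨i, b⟩ := d
      cases b
      · exact ⟨t, rfl⟩
      · exact ⟨unitInterval.symm t, by rw [dart_true, unitInterval.symm_symm]⟩
    rw [← hu] at ht ⊢
    have hu0 : u ≠ 0 := by rintro rfl; exact ht rfl
    have key : ∀ v, min u third ≤ v → v ≤ max u third → dart e d v ∈ ({dart e d 0}ᶜ : Set X) := by
      intro v hv hv' h
      have hv0 : v ≠ 0 := (lt_of_lt_of_le (lt_min (unitInterval.pos_iff_ne_zero.mpr hu0)
        (unitInterval.pos_iff_ne_zero.mpr third_ne_zero)) hv).ne'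
      by_cases hv1 : v = 1
      · subst hv1
        rcases le_max_iff.mp hv' with h' | h'
        · exact ht (le_antisymm unitInterval.le_one' h' ▸ h)
        · exact third_ne_one (le_antisymm unitInterval.le_one' h')
      · exact he.dart_ne_vertex hv0 hv1 h
    rcases le_total u third with h | h
    · exact joinedIn_segment _ h fun v hv hv' =>
        key v (by rwa [min_eq_left h]) (by rwa [max_eq_right h])
    · exact (joinedIn_segment _ h fun v hv hv' =>
        key v (by rwa [min_eq_right h]) (by rwa [max_eq_left h])).symm
  obtain ⟨j, t, rfl⟩ := he.cover y
  obtain ⟨d₀, hd₀⟩ := (mem_vertexSet_iff_dart e).mp hx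
  -- An edge either has an endpoint at `x`, and `hA` applies, or avoids `x` and can be followed to a
  -- neighbouring edge.
  refine he.edge_induction (P := fun j => ∀ t, e j t ≠ x →
    ∃ d, dart e d 0 = x ∧ JoinedIn {x}ᶜ (e j t) (dart e d third)) (i₀ := d₀.1) (hA d₀ hd₀) ?_ j t hy
  intro i j s t hi hst u hu
  by_cases hj : ∃ v, e j v = x
  · obtain ⟨v, hv⟩ := hj
    rw [← hv, he.apply_mem_vertexSet_iff] at hx
    obtain ⟨d, rfl, hd⟩ := exists_dart_of_apply hx hv
    exact hA d hd u hu
  · push Not at hj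
    obtain ⟨d, hd, h⟩ := hi s (hst ▸ hj t)
    refine ⟨d, hd, JoinedIn.trans ?_ (hst ▸ h)⟩
    rcases le_total u t with h | h
    · exact joinedIn_segment _ h fun v _ _ => hj v
    · exact (joinedIn_segment _ h fun v _ _ => hj v).symm

/-- Two distinct darts may be the two ends of one loop; their initial thirds are still disjoint
because `1 / 3 < 1 / 2`. -/
theorem dart_segment_ne (he : IsEdgeSystem e) {a c : ι × Bool} (hac : a ≠ c) {v : I}
    (hv : v ≤ third) : dart e a third ≠ dart e c v := by
  intro h
  rcases he.dart_inj third_ne_zero third_ne_one h with h | h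
  · exact hac h.1
  · have hv' : (v : ℝ) ≤ 1 / 3 := hv
    have := congrArg Subtype.val h.2
    rw [unitInterval.coe_symm_eq, coe_third] at this
    linarith

/-- A vertex at which three edges start is slidable. -/
theorem isSlidable_of_three_darts [Finite ι] [T2Space X] [PreconnectedSpace X]
    (he : IsEdgeSystem e) {x : X} {d₁ d₂ d₃ : ι × Bool} (h₁ : dart e d₁ 0 = x)
    (h₂ : dart e d₂ 0 = x) (h₃ : dart e d₃ 0 = x) (h₁₂ : d₁ ≠ d₂) (h₁₃ : d₁ ≠ d₃) (h₂₃ : d₂ ≠ d₃) :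
    IsSlidable x := by
  have hx : x ∈ vertexSet e := (mem_vertexSet_iff_dart e).mpr ⟨d₁, h₁⟩
  intro y y' hy hy'
  obtain ⟨a, ha, hya⟩ := he.exists_joinedIn_dart hx hy
  obtain ⟨b, hb, hyb⟩ := he.exists_joinedIn_dart hx hy'
  refine (Slides.of_joinedIn hya).trans (.trans ?_ (Slides.of_joinedIn hyb).symm)
  -- The first particle steps aside onto a dart `c` other than `a` and `b`, which frees the vertex
  -- for the second one to pass from `a` to `b`.
  obtain ⟨c, hc, hac, hbc⟩ : ∃ c, dart e c 0 = x ∧ a ≠ c ∧ b ≠ c := by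
    by_cases h1 : a ≠ d₁ ∧ b ≠ d₁
    · exact ⟨d₁, h₁, h1⟩
    by_cases h2 : a ≠ d₂ ∧ b ≠ d₂
    · exact ⟨d₂, h₂, h2⟩
    refine ⟨d₃, h₃, ?_, ?_⟩
    · rintro rfl
      exact h1 ⟨h₁₃.symm, fun h => h2 ⟨h₂₃.symm, fun h' => h₁₂ (h.symm.trans h')⟩⟩
    · rintro rfl
      exact h1 ⟨fun h => h2 ⟨fun h' => h₁₂ (h.symm.trans h'), h₂₃.symm⟩, h₁₃.symm⟩
  subst hc
  have hpath : ∀ a, a ≠ c → ∀ t, segment (dart e c) 0 third t ≠ dart e a third := by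
    intro a hac t ht
    obtain ⟨v, ⟨-, hv⟩, hvt⟩ := range_segment_subset (dart e c)
      (unitInterval.nonneg' (t := third)) (u := t)
    exact he.dart_segment_ne hac hv (ht.symm.trans hvt)
  refine Slides.of_path (segment (dart e c) 0 third) (hpath a hac) (hpath b hbc)
    (Slides.of_joinedIn ?_)
  have hjoin : ∀ a, a ≠ c → JoinedIn {dart e c third}ᶜ (dart e a 0) (dart e a third) :=
    fun a hac => joinedIn_segment _ unitInterval.nonneg' fun v _ hv h =>
      he.dart_segment_ne hac.symm hv h.symm
  have h1 := (hjoin a hac).symm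
  rw [ha, ← hb] at h1
  exact h1.trans (hjoin b hbc)

/-- The interior points of an edge whose endpoints can be joined off that edge are slidable. -/
theorem isSlidable_of_joinedIn [Finite ι] [T2Space X] [PreconnectedSpace X]
    (he : IsEdgeSystem e) {j : ι} {s : I} (h0 : s ≠ 0) (h1 : s ≠ 1)
    (h : JoinedIn {e j s}ᶜ (e j 0) (e j 1)) : IsSlidable (e j s) := by
  -- The complement of `e j s` is path connected, so the first particle need not move at all.
  have key : ∀ y, y ≠ e j s → JoinedIn {e j s}ᶜ y (e j 0) := by
    intro y hy
    obtain ⟨k, t, rfl⟩ := he.cover y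
    have hj : ∀ t, e j t ≠ e j s → JoinedIn {e j s}ᶜ (e j t) (e j 0) := by
      intro t ht
      rcases lt_or_ge t s with hts | hts
      · refine (joinedIn_segment (F := {e j s}ᶜ) (t := t) (e j) unitInterval.nonneg'
          fun v _ hv h' => ?_).symm
        exact (hv.trans_lt hts).ne (he.inj' h0 h1 h').2
      · refine JoinedIn.trans (joinedIn_segment _ unitInterval.le_one' fun v hv _ h' => ?_) h.symm
        obtain rfl := (he.inj' h0 h1 h').2
        exact ht (by rw [le_antisymm hts hv])
    refine he.edge_induction (P := fun k => ∀ t, e k t ≠ e j s → JoinedIn {e j s}ᶜ (e k t) (e j 0))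
      (i₀ := j) hj ?_ k t hy
    intro i k u v hi huv t ht
    by_cases hkj : k = j
    · subst hkj
      exact hj t ht
    · have hk : ∀ w, e k w ≠ e j s := fun w hw => hkj (he.inj' h0 h1 hw).1
      refine JoinedIn.trans ?_ (huv ▸ hi u (huv ▸ hk v))
      rcases le_total t v with h | h
      · exact joinedIn_segment _ h fun w _ _ => hk w
      · exact (joinedIn_segment _ h fun w _ _ => hk w).symm
  exact fun y y' hy hy' => Slides.of_joinedIn ((key y hy).trans (key y' hy').symm)

end IsEdgeSystem

end GraphBU

/-! ### Slidability in graphs other than intervals -/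

namespace GraphBU

open scoped unitInterval
open Set

variable {ι X : Type*} [TopologicalSpace X]

/-- `a` is an embedded arc that runs through exactly the edges in `S`. -/
structure IsEdgeArc (e : ι → C(I, X)) (S : Set ι) (a : C(I, X)) : Prop where
  injective : Function.Injective a
  range_eq : range a = ⋃ i ∈ S, range (e i)
  start : ∃ d : ι × Bool, d.1 ∈ S ∧ dart e d 0 = a 0
  finish : ∃ d : ι × Bool, d.1 ∈ S ∧ dart e d 0 = a 1
  mid : ∀ c, c ≠ 0 → c ≠ 1 → a c ∈ vertexSet e → ∃ d d' : ι × Bool,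
    d ≠ d' ∧ d.1 ∈ S ∧ d'.1 ∈ S ∧ dart e d 0 = a c ∧ dart e d' 0 = a c

theorem Path.trans_injective {a b c : X} {p : Path a b} {q : Path b c}
    (hp : Function.Injective p) (hq : Function.Injective q)
    (h : ∀ s t, p s = q t → t = 0) : Function.Injective (p.trans q) := by
  have hpq : ∀ s t, p s = q t → s = 1 ∧ t = 0 := fun s t hst => by
    obtain rfl := h s t hst
    refine ⟨hp (hst.trans ?_), rfl⟩
    rw [q.source, p.target]
  intro s t hst
  rw [Path.trans_apply, Path.trans_apply] at hst
  split_ifs at hst with h1 h2 h2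
  · have := congrArg Subtype.val (hp hst)
    simp only at this
    exact Subtype.ext (by linarith)
  · have := congrArg Subtype.val (hpq _ _ hst).2
    simp only [Icc.coe_zero] at this
    linarith
  · have := congrArg Subtype.val (hpq _ _ hst.symm).2
    simp only [Icc.coe_zero] at this
    linarith
  · have := congrArg Subtype.val (hq hst)
    simp only at this
    exact Subtype.ext (by linarith)

theorem IsEdgeArc.symm {e : ι → C(I, X)} {S : Set ι} {a : C(I, X)} (ha : IsEdgeArc e S a) :
    IsEdgeArc e S (a.comp ⟨unitInterval.symm, unitInterval.continuous_symm⟩) where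
  injective s t h := unitInterval.symm_inj.mp (ha.injective h)
  range_eq := by
    rw [← ha.range_eq]
    exact unitInterval.symm_bijective.surjective.range_comp a
  start := by
    obtain ⟨d, hd, h⟩ := ha.finish
    exact ⟨d, hd, h.trans (congrArg a unitInterval.symm_zero.symm)⟩
  finish := by
    obtain ⟨d, hd, h⟩ := ha.start
    exact ⟨d, hd, h.trans (congrArg a unitInterval.symm_one.symm)⟩
  mid c h0 h1 h := ha.mid _ (symm_interior h0 h1).1 (symm_interior h0 h1).2 h

variable {e : ι → C(I, X)}

theorem range_dart (d : ι × Bool) : range (dart e d) = range (e d.1) := by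
  obtain ⟨i, b⟩ := d
  cases b
  · rfl
  · exact unitInterval.symm_bijective.surjective.range_comp (e i)

namespace IsEdgeSystem

theorem isEdgeArc_singleton (he : IsEdgeSystem e) {i : ι} (hi : e i 0 ≠ e i 1) :
    IsEdgeArc e {i} (e i) where
  injective s t h := by
    by_cases hs : s ≠ 0 ∧ s ≠ 1
    · exact (he.inj hs.1 hs.2 h).2
    by_cases ht : t ≠ 0 ∧ t ≠ 1
    · exact (he.inj' ht.1 ht.2 h).2
    rcases not_and_or.mp hs with hs | hs <;> rcases not_and_or.mp ht with ht | ht <;>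
      rw [not_not] at hs ht <;> subst hs <;> subst ht
    · rfl
    · exact (hi h).elim
    · exact (hi h.symm).elim
    · rfl
  range_eq := by simp
  start := ⟨(i, false), rfl, rfl⟩
  finish := ⟨(i, true), rfl, by rw [dart_true, unitInterval.symm_zero]⟩
  mid c h0 h1 h := (he.apply_notMem_vertexSet h0 h1 h).elim

theorem dart_injective (he : IsEdgeSystem e) {d : ι × Bool} (hd : dart e d 0 ≠ dart e d 1) :
    Function.Injective (dart e d) := by
  obtain ⟨i, b⟩ := d
  cases b
  · exact (he.isEdgeArc_singleton hd).injective
  · refine (he.isEdgeArc_singleton ?_).symm.injective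
    rw [dart_true, dart_true, unitInterval.symm_zero, unitInterval.symm_one] at hd
    exact hd.symm

/-- An arc can be prolonged by an edge that meets it only in its last point. -/
theorem exists_isEdgeArc_insert (he : IsEdgeSystem e) {S : Set ι} {a : C(I, X)} (ha : IsEdgeArc e S a)
    {d : ι × Bool} (hdS : d.1 ∉ S) (hd : dart e d 0 = a 1) (hd1 : dart e d 1 ∉ range a) :
    ∃ a', IsEdgeArc e (insert d.1 S) a' := by
  have hne : dart e d 0 ≠ dart e d 1 := fun h => hd1 ⟨1, hd.symm.trans h⟩
  let p : Path (a 0) (a 1) := ⟨a, rfl, rfl⟩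
  let q : Path (a 1) (dart e d 1) := ⟨dart e d, hd, rfl⟩
  have hpq : ∀ s t, p s = q t → t = 0 := by
    intro s t hst
    change a s = dart e d t at hst
    by_contra ht0
    by_cases ht1 : t = 1
    · subst ht1
      exact hd1 ⟨s, hst⟩
    · have : a s ∈ range a := ⟨s, rfl⟩
      rw [ha.range_eq] at this
      simp only [mem_iUnion] at this
      obtain ⟨i, hi, u, hu⟩ := this
      obtain ⟨t', ht'⟩ := dart_mem_range e d t
      rcases he.dart_inj (d' := (i, false)) ht0 ht1 (hst.symm.trans hu.symm) with h | h
      · exact hdS (by rw [h.1]; exact hi)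
      · exact hdS ((congrArg Prod.fst h.1 : i = d.1) ▸ hi)
  have hS : ∀ {i}, i ∈ S → i ∈ insert d.1 S := fun h => Or.inr h
  refine ⟨(p.trans q).toContinuousMap,
    Path.trans_injective ha.injective (he.dart_injective hne) hpq, ?_, ?_, ?_, ?_⟩
  · change range (p.trans q) = _
    rw [Path.trans_range, biUnion_insert, ← ha.range_eq, ← range_dart d, union_comm]
    rfl
  · obtain ⟨d', hd', h⟩ := ha.start
    exact ⟨d', hS hd', h.trans (p.trans q).source.symm⟩
  · exact ⟨dartRev d, Or.inl rfl, (dart_rev_zero e d).trans (p.trans q).target.symm⟩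
  · intro c h0 h1 hc
    change (p.trans q) c ∈ vertexSet e at hc
    change ∃ d₁ d' : ι × Bool, d₁ ≠ d' ∧ d₁.1 ∈ insert d.1 S ∧ d'.1 ∈ insert d.1 S ∧
      dart e d₁ 0 = (p.trans q) c ∧ dart e d' 0 = (p.trans q) c
    rw [Path.trans_apply] at hc ⊢
    split_ifs at hc ⊢ with h
    · set u : I := ⟨2 * (c : ℝ), _⟩ with hu
      have huc : (u : ℝ) = 2 * c := rfl
      change a u ∈ vertexSet e at hc
      change ∃ d₁ d' : ι × Bool, d₁ ≠ d' ∧ d₁.1 ∈ insert d.1 S ∧ d'.1 ∈ insert d.1 S ∧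
        dart e d₁ 0 = a u ∧ dart e d' 0 = a u
      have hu0 : u ≠ 0 := fun h => h0 (Subtype.ext (by
        have := congrArg Subtype.val h
        rw [huc, Icc.coe_zero] at this
        rw [Icc.coe_zero]
        linarith))
      by_cases hu1 : u = 1
      -- At the junction the two darts are the last one of the old arc and the new one.
      · rw [hu1]
        obtain ⟨d', hd', h'⟩ := ha.finish
        exact ⟨d', d, fun h => hdS (h ▸ hd'), hS hd', Or.inl rfl, h', hd⟩
      · obtain ⟨d₁, d₂, h12, h1, h2, h1', h2'⟩ := ha.mid u hu0 hu1 hc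
        exact ⟨d₁, d₂, h12, hS h1, hS h2, h1', h2'⟩
    · set u : I := ⟨2 * (c : ℝ) - 1, _⟩ with hu
      have huc : (u : ℝ) = 2 * c - 1 := rfl
      change dart e d u ∈ vertexSet e at hc
      have hu0 : u ≠ 0 := fun h' => h (by
        have := congrArg Subtype.val h'
        rw [huc, Icc.coe_zero] at this
        linarith)
      have hu1 : u ≠ 1 := fun h' => h1 (Subtype.ext (by
        have := congrArg Subtype.val h'
        rw [huc, Icc.coe_one] at this
        rw [Icc.coe_one]
        linarith))
      obtain ⟨d', hd'⟩ := (mem_vertexSet_iff_dart e).mp hc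
      exact (he.dart_ne_vertex hu0 hu1 hd'.symm).elim

/-- A graph that is not an interval has an edge whose interior points are slidable. -/
theorem exists_isSlidable_edge [Finite ι] [T2Space X] [ConnectedSpace X]
    (he : IsEdgeSystem e) (hX : ¬ Nonempty (X ≃ₜ I)) :
    ∃ j, ∀ s, s ≠ 0 → s ≠ 1 → IsSlidable (e j s) := by
  by_contra hcon
  push Not at hcon
  have hjoin : ∀ d : ι × Bool, ¬ ∀ s, s ≠ 0 → s ≠ 1 →
      JoinedIn {e d.1 s}ᶜ (dart e d 0) (dart e d 1) := by
    rintro ⟨j, b⟩ h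
    obtain ⟨s, h0, h1, hs⟩ := hcon j
    refine hs (he.isSlidable_of_joinedIn h0 h1 ?_)
    cases b
    · exact h s h0 h1
    · have := (h s h0 h1).symm
      rwa [dart_true, dart_true, unitInterval.symm_zero, unitInterval.symm_one] at this
  -- A loop would have its endpoints joined off its interior by a constant path.
  have hloop : ∀ i, e i 0 ≠ e i 1 := by
    intro i hi
    refine hjoin (i, false) fun s h0 h1 => ?_
    rw [dart_false, dart_false, ← hi]
    exact JoinedIn.refl fun h => h0 (he.inj' h0 h1 h).2.symm
  obtain ⟨i₀⟩ := he.nonempty_index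
  obtain ⟨S, ⟨a, ha⟩, hmax⟩ := (toFinite {S : Set ι | ∃ a, IsEdgeArc e S a}).exists_maximal
    ⟨{i₀}, e i₀, he.isEdgeArc_singleton (hloop i₀)⟩
  have hext : ∀ a, IsEdgeArc e S a → ∀ d : ι × Bool, d.1 ∉ S → dart e d 0 = a 1 →
      dart e d 1 ∉ range a → False := by
    intro a ha d hdS hd hd1
    obtain ⟨a', ha'⟩ := he.exists_isEdgeArc_insert ha hdS hd hd1
    exact hdS (hmax ⟨a', ha'⟩ (subset_insert _ _) (mem_insert _ _))
  have hmem : ∀ i ∈ S, ∀ s, e i s ∈ range a := fun i hi s => by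
    rw [ha.range_eq]
    exact mem_biUnion hi ⟨s, rfl⟩
  have hnot : ∀ j ∉ S, ∀ s, s ≠ 0 → s ≠ 1 → e j s ∉ range a := by
    intro j hj s h0 h1 h
    rw [ha.range_eq] at h
    simp only [mem_iUnion] at h
    obtain ⟨i, hi, t, ht⟩ := h
    exact hj ((he.inj' h0 h1 ht).1 ▸ hi)
  -- A maximal arc through all edges would be a homeomorphism from `I`, so by connectedness some
  -- edge outside `S` meets one in `S`.
  have hall : ∃ i j s t, i ∈ S ∧ e i s = e j t ∧ j ∉ S := by
    by_contra! h
    have hS : ∀ j, j ∈ S := by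
      obtain ⟨d, hd, -⟩ := ha.start
      exact he.edge_induction hd h
    refine hX ⟨(Equiv.toHomeomorphOfContinuousClosed (Equiv.ofBijective a ⟨ha.injective, ?_⟩)
      a.continuous a.continuous.isClosedMap).symm⟩
    intro x
    obtain ⟨i, s, rfl⟩ := he.cover x
    exact hmem i (hS i) s
  obtain ⟨i, j, s, t, hi, hst, hj⟩ := hall
  have ht : t = 0 ∨ t = 1 := by
    by_contra! h
    exact hnot j hj t h.1 h.2 (hst ▸ hmem i hi s)
  obtain ⟨d, rfl, hd⟩ := exists_dart_of_apply ht hst.symm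
  obtain ⟨c, hc⟩ : dart e d 0 ∈ range a := hd ▸ hmem i hi s
  -- If `d` returns to the arc, the arc joins its endpoints off it; if it leaves from an end of the
  -- arc, it prolongs it; if it leaves from an inner vertex, it is a third dart there.
  by_cases hw : dart e d 1 ∈ range a
  · obtain ⟨c', hc'⟩ := hw
    refine hjoin d fun s h0 h1 => ?_
    have havoid : ∀ v, a v ∈ ({e d.1 s}ᶜ : Set X) := fun v h => hnot d.1 hj s h0 h1 ⟨v, h⟩
    rw [← hc, ← hc']
    rcases le_total c c' with h | h
    · exact joinedIn_segment a h fun v _ _ => havoid v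
    · exact (joinedIn_segment a h fun v _ _ => havoid v).symm
  by_cases hc1 : c = 1
  · subst hc1
    exact hext a ha d hj hc.symm hw
  by_cases hc0 : c = 0
  · subst hc0
    refine hext _ ha.symm d hj ?_ ?_
    · change dart e d 0 = a (unitInterval.symm 1)
      rw [unitInterval.symm_one, hc]
    · rw [ha.symm.range_eq, ← ha.range_eq]
      exact hw
  obtain ⟨d₁, d₂, h12, h1, h2, h1', h2'⟩ := ha.mid c hc0 hc1
    ((mem_vertexSet_iff_dart e).mpr ⟨d, hc.symm⟩)
  have hd1 : d ≠ d₁ := fun h => hj (h ▸ h1)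
  have hd2 : d ≠ d₂ := fun h => hj (h ▸ h2)
  have hv : IsSlidable (dart e d 0) :=
    he.isSlidable_of_three_darts rfl (h1'.trans hc) (h2'.trans hc) hd1 hd2 h12
  obtain ⟨s, h0, h1, hs⟩ := hcon d.1
  have hall : ∀ s, s ≠ 0 → s ≠ 1 → IsSlidable (dart e d s) := fun s h0 h1 =>
    he.isSlidable_of_start hd1 (h1'.trans hc) h0 h1 hv
  obtain ⟨k, b⟩ := d
  cases b
  · exact hs (hall s h0 h1)
  · have := hall _ (symm_interior h0 h1).1 (symm_interior h0 h1).2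
    rw [dart_true, unitInterval.symm_symm] at this
    exact hs this

/-- In a graph that is not an interval, all points are slidable. -/
theorem isSlidable [Finite ι] [T2Space X] [ConnectedSpace X]
    (he : IsEdgeSystem e) (hX : ¬ Nonempty (X ≃ₜ I)) (x : X) : IsSlidable x := by
  obtain ⟨j₀, hj₀⟩ := he.exists_isSlidable_edge hX
  have hdart : ∀ d : ι × Bool, (∀ s, s ≠ 0 → s ≠ 1 → IsSlidable (e d.1 s)) ↔
      ∀ s, s ≠ 0 → s ≠ 1 → IsSlidable (dart e d s) := by
    rintro ⟨i, b⟩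
    cases b
    · rfl
    · constructor
      · exact fun h s h0 h1 => h _ (symm_interior h0 h1).1 (symm_interior h0 h1).2
      · intro h s h0 h1
        have := h _ (symm_interior h0 h1).1 (symm_interior h0 h1).2
        rwa [dart_true, unitInterval.symm_symm] at this
  have hstart : ∀ d : ι × Bool, (∀ s, s ≠ 0 → s ≠ 1 → IsSlidable (e d.1 s)) →
      IsSlidable (dart e d 0) := fun d hd =>
    he.isSlidable_start third_ne_one ((hdart d).mp hd third third_ne_zero third_ne_one)
  -- Between different edges that meet, slidability passes inward to the common vertex and then out
  -- along the other edge; the old edge serves as the siding there.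
  have hedge : ∀ j, ∀ s, s ≠ 0 → s ≠ 1 → IsSlidable (e j s) := by
    refine he.edge_induction hj₀ ?_
    intro i j s t hi hst
    by_cases hij : i = j
    · exact hij ▸ hi
    have hs : s = 0 ∨ s = 1 := by
      by_contra! h
      exact hij (he.inj h.1 h.2 hst).1
    have ht : t = 0 ∨ t = 1 := by
      by_contra! h
      exact hij (he.inj' h.1 h.2 hst).1
    obtain ⟨d, rfl, hd⟩ := exists_dart_of_apply hs (rfl : e i s = e i s)
    obtain ⟨d', rfl, hd'⟩ := exists_dart_of_apply ht (rfl : e j t = e j t)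
    have hdd : dart e d 0 = dart e d' 0 := hd.trans (hst.trans hd'.symm)
    have := hstart d hi
    exact (hdart d').mpr fun s h0 h1 =>
      he.isSlidable_of_start (d' := d) (fun h => hij (h ▸ rfl)) hdd h0 h1 (hdd ▸ this)
  rcases he.mem_vertexSet_or x with h | ⟨i, s, h0, h1, rfl⟩
  · obtain ⟨d, rfl⟩ := (mem_vertexSet_iff_dart e).mp h
    exact hstart d (hedge d.1)
  · exact hedge i s h0 h1

end IsEdgeSystem

theorem Slides.joined {x y y' : X} (h : Slides x y y') (hy : x ≠ y) (hy' : x ≠ y') :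
    ∃ γ : Path (⟨(x, y), hy⟩ : Conf₂ X) ⟨(x, y'), hy'⟩,
      (γ.map (fstProj X).continuous).Homotopic (Path.refl x) := by
  obtain ⟨p, q, h, hp⟩ := h
  refine ⟨⟨⟨fun t => ⟨(p t, q t), h t⟩, by fun_prop⟩, ?_, ?_⟩, ?_⟩
  · exact Subtype.ext (Prod.ext p.source q.source)
  · exact Subtype.ext (Prod.ext p.target q.target)
  · exact hp

/-- The relation `r` ignores the second particle. Slidability makes `r` reflexive, so it suffices to
move the first particle along edges with the second parked wherever convenient. -/
theorem IsEdgeSystem.pathConnectedSpace_conf [Finite ι] [T2Space X] [ConnectedSpace X]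
    [Nontrivial X] (he : IsEdgeSystem e) (hX : ¬ Nonempty (X ≃ₜ I)) :
    PathConnectedSpace (Conf₂ X) := by
  let r : X → X → Prop := fun x x' => ∀ y y' (h : x ≠ y) (h' : x' ≠ y'),
    Joined (⟨(x, y), h⟩ : Conf₂ X) ⟨(x', y'), h'⟩
  have hrefl : ∀ x, r x x := fun x y y' h h' =>
    (((he.isSlidable hX x y y' h.symm h'.symm)).joined h h').nonempty
  have hr : Equivalence r := by
    refine ⟨hrefl, fun {x x'} h y y' hy hy' => (h y' y hy' hy).symm, ?_⟩
    intro x x' x'' h h' y y' hy hy'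
    obtain ⟨z, hz⟩ := exists_ne x'
    exact (h y z hy hz.symm).trans (h' z y' hz.symm hy')
  -- The second particle is parked at some `u` strictly between `s` and `1`, which is why `s = 1` is
  -- excluded.
  have hdart : ∀ d s, s ≠ 1 → r (dart e d 0) (dart e d s) := by
    intro d s hs y y' hy hy'
    obtain ⟨u, hsu, hu1⟩ := exists_between (unitInterval.lt_one_iff_ne_one.mpr hs)
    have hu0 : u ≠ 0 := (lt_of_le_of_lt unitInterval.nonneg' hsu).ne'
    have hne : ∀ v ≤ s, dart e d v ≠ dart e d u := fun v hv h =>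
      (hv.trans_lt hsu).ne' (he.dart_inj_self hu0 hu1.ne h.symm)
    have hne' : ∀ t, segment (dart e d) 0 s t ≠ dart e d u := fun t h => by
      obtain ⟨v, ⟨-, hv⟩, hvt⟩ := range_segment_subset (dart e d)
        (unitInterval.nonneg' (t := s)) (u := t)
      exact hne v hv (hvt.symm.trans h)
    have hmid : Joined (⟨(dart e d 0, dart e d u), hne 0 unitInterval.nonneg'⟩ : Conf₂ X)
        ⟨(dart e d s, dart e d u), hne s le_rfl⟩ :=
      ⟨⟨⟨fun t => ⟨(segment (dart e d) 0 s t, dart e d u), hne' t⟩, by fun_prop⟩,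
        Subtype.ext (Prod.ext (segment (dart e d) 0 s).source rfl),
        Subtype.ext (Prod.ext (segment (dart e d) 0 s).target rfl)⟩⟩
    exact (hrefl _ _ _ _ _).trans (hmid.trans (hrefl _ _ _ _ _))
  have hedge : ∀ i s, r (e i 0) (e i s) := by
    intro i s
    by_cases hs : s = 1
    · subst hs
      -- A whole edge is covered from both ends, meeting at the point with parameter `1 / 3`.
      refine hr.trans (hdart (i, false) third third_ne_one) (hr.symm ?_)
      have := hdart (i, true) (unitInterval.symm third) (symm_interior third_ne_zero third_ne_one).2
      rwa [dart_true, dart_true, unitInterval.symm_zero, unitInterval.symm_symm] at this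
    · exact hdart (i, false) s hs
  have hall := he.equivalence_induction hr fun i s t => hr.trans (hr.symm (hedge i s)) (hedge i t)
  obtain ⟨x, y, hxy⟩ := exists_pair_ne X
  exact ⟨⟨⟨(x, y), hxy⟩⟩, fun c c' => hall c.1.1 c'.1.1 c.1.2 c'.1.2 c.2 c'.2⟩

end GraphBU

/-! ### Double coverings, monodromy and change of base point -/

namespace GraphBU

open scoped unitInterval
open Set

namespace FreeInvolution

variable {X Y : Type*} [TopologicalSpace X] [TopologicalSpace Y] (τ : FreeInvolution X)

theorem isCoveringMap_proj [T2Space X] : IsCoveringMap τ.proj :=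
  letI := τ.action
  τ.isAddQuotientCoveringMap.isCoveringMap

theorem projHom_injective [T2Space X] (x₀ : X) : Function.Injective (τ.projHom x₀) :=
  τ.isCoveringMap_proj.injective_path_homotopic_map x₀ x₀

theorem ker_classifyingHom [T2Space X] (x₀ : X) :
    (τ.classifyingHom x₀).ker = (τ.projHom x₀).range := by
  let _ := τ.action
  have h := τ.isAddQuotientCoveringMap.ker_monodromyPerm
    (⟨x₀, rfl⟩ : τ.proj ⁻¹' {τ.proj x₀})
  rw [← τ.isAddQuotientCoveringMap.ker_fundamentalGroupToMulOpposite] at h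
  have h' : FundamentalGroup.mapOfEq ⟨τ.proj, τ.isAddQuotientCoveringMap.continuous⟩
      (rfl : τ.proj x₀ = τ.proj x₀) = τ.projHom x₀ := by
    ext p
    rw [FundamentalGroup.mapOfEq_apply, Path.Homotopic.Quotient.cast_rfl_rfl]
    rfl
  rw [← h']
  refine Eq.trans ?_ h
  ext γ
  rw [MonoidHom.mem_ker, MonoidHom.mem_ker, classifyingHom]
  exact (MulOpposite.opMulEquiv (M := Multiplicative (ZMod 2))).symm.map_eq_one_iff

theorem isShortExact [T2Space X] [PathConnectedSpace X] (x₀ : X) :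
    IsShortExact (τ.projHom x₀) (τ.classifyingHom x₀) := by
  refine ⟨τ.projHom_injective x₀, (τ.ker_classifyingHom x₀).symm, ?_⟩
  let _ := τ.action
  exact (MulOpposite.opMulEquiv (M := Multiplicative (ZMod 2))).symm.surjective.comp
    (τ.isAddQuotientCoveringMap.fundamentalGroupToMulOpposite_surjective _)

/-- A homomorphism to `ℤ₂` is determined by its kernel, and here the kernels are the images of the
covering projections. -/
theorem classifyingHom_comp_eq_iff [T2Space X] [T2Space Y] (ρ : FreeInvolution Y) {x₀ : X} {y₀ : Y}
    (ψ : FundamentalGroup τ.Orbit (τ.proj x₀) →* FundamentalGroup ρ.Orbit (ρ.proj y₀)) :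
    (ρ.classifyingHom y₀).comp ψ = τ.classifyingHom x₀ ↔
      ∀ ℓ, ψ ℓ ∈ (ρ.projHom y₀).range ↔ ℓ ∈ (τ.projHom x₀).range := by
  have key : ∀ a b : Multiplicative (ZMod 2), a = b ↔ (a = 1 ↔ b = 1) := by decide
  simp only [← ker_classifyingHom, MonoidHom.mem_ker, DFunLike.ext_iff, MonoidHom.comp_apply]
  exact forall_congr' fun ℓ => key _ _

/-- Monodromy sends `x₀` to `x₁` along this class, but fixes `x₀` along projected loops. -/
theorem mk_map_cast_notMem_range [T2Space X] {x₀ x₁ : X} (L : Path x₀ x₁) (hx : x₁ ≠ x₀)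
    (h : τ.proj x₀ = τ.proj x₁) :
    (Path.Homotopic.Quotient.mk ((L.map τ.proj.continuous).cast rfl h) :
      FundamentalGroup τ.Orbit (τ.proj x₀)) ∉ (τ.projHom x₀).range := by
  rintro ⟨p, hp⟩
  have h1 := τ.isCoveringMap_proj.monodromy_eq_of_map_eq
    (γ := (Path.Homotopic.Quotient.mk ((L.map τ.proj.continuous).cast rfl h)))
    (ex := ⟨x₀, rfl⟩) (ey := ⟨x₁, h.symm⟩) (.mk L) rfl
  have h2 := τ.isCoveringMap_proj.monodromy_map p
  have h3 : Path.Homotopic.Quotient.map p ⟨τ.proj, τ.isCoveringMap_proj.continuous⟩ =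
    Path.Homotopic.Quotient.mk ((L.map τ.proj.continuous).cast rfl h) := hp
  rw [h3, h1] at h2
  exact hx (congrArg Subtype.val h2)

theorem exists_mk_map_cast_of_notMem_range [T2Space X] {x₀ : X}
    {ℓ : FundamentalGroup τ.Orbit (τ.proj x₀)} (hℓ : ℓ ∉ (τ.projHom x₀).range) :
    ∃ L : Path x₀ (τ.toMap x₀),
      ℓ = Path.Homotopic.Quotient.mk
        ((L.map τ.proj.continuous).cast rfl (τ.proj_toMap x₀).symm) := by
  obtain ⟨γ, rfl⟩ := Path.Homotopic.Quotient.mk_surjective ℓ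
  let cov := τ.isCoveringMap_proj
  let L := cov.liftPath γ x₀ γ.source
  have hL : ∀ t, τ.proj (L t) = γ t := congrFun (cov.liftPath_lifts γ x₀ γ.source)
  have hL0 : L 0 = x₀ := cov.liftPath_zero γ x₀ γ.source
  have hL1 : τ.proj (L 1) = τ.proj x₀ := (hL 1).trans γ.target
  rcases τ.proj_eq_iff.mp hL1 with h1 | h1
  · refine absurd ⟨Path.Homotopic.Quotient.mk ⟨L, hL0, h1⟩, ?_⟩ hℓ
    exact congrArg Path.Homotopic.Quotient.mk (Path.ext (funext hL))
  · refine ⟨⟨L, hL0, h1⟩, ?_⟩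
    exact congrArg Path.Homotopic.Quotient.mk (Path.ext (funext fun t => (hL t).symm))

/-- The map between orbit spaces induced by an equivariant map. -/
def orbitMap {τ : FreeInvolution X} {ρ : FreeInvolution Y} (F : C(X, Y))
    (hF : ∀ x, F (τ.toMap x) = ρ.toMap (F x)) : C(τ.Orbit, ρ.Orbit) where
  toFun := Quotient.map F <| by
    rintro x y (rfl | rfl)
    · exact Or.inl rfl
    · exact Or.inr (hF y)
  continuous_toFun := F.continuous.quotient_map' _

variable {τ} {ρ : FreeInvolution Y} {F : C(X, Y)} (hF : ∀ x, F (τ.toMap x) = ρ.toMap (F x))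

theorem map_orbitMap_projHom (x₀ : X) (p : FundamentalGroup X x₀) :
    FundamentalGroup.map (orbitMap F hF) (τ.proj x₀) (τ.projHom x₀ p) =
      ρ.projHom (F x₀) (FundamentalGroup.map F x₀ p) := by
  obtain ⟨γ, rfl⟩ := Path.Homotopic.Quotient.mk_surjective p
  rfl

/-- A lift from `x₀` to `τ x₀` is carried to a path from `F x₀` to `ρ (F x₀)`, which is not closed
because `ρ` is free. -/
theorem map_orbitMap_mem_range_iff [T2Space X] [T2Space Y] {x₀ : X}
    (ℓ : FundamentalGroup τ.Orbit (τ.proj x₀)) :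
    FundamentalGroup.map (orbitMap F hF) (τ.proj x₀) ℓ ∈ (ρ.projHom (F x₀)).range ↔
      ℓ ∈ (τ.projHom x₀).range := by
  constructor
  · contrapose
    intro hℓ
    obtain ⟨L, rfl⟩ := τ.exists_mk_map_cast_of_notMem_range hℓ
    exact ρ.mk_map_cast_notMem_range (L.map F.continuous)
      (by rw [hF]; exact ρ.free _)
      (congrArg (orbitMap F hF) (τ.proj_toMap x₀).symm)
  · rintro ⟨p, rfl⟩
    exact ⟨_, (map_orbitMap_projHom hF x₀ p).symm⟩

end FreeInvolution

section BasePoint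

variable {X Y : Type*} [TopologicalSpace X] [TopologicalSpace Y]

open Path.Homotopic.Quotient in
/-- The change of base point along a path class. -/
noncomputable def conjHom {a b : X} (γ : Path.Homotopic.Quotient a b) :
    FundamentalGroup X b →* FundamentalGroup X a where
  toFun p := γ.trans (Path.Homotopic.Quotient.trans p γ.symm)
  map_one' := by
    change γ.trans ((Path.Homotopic.Quotient.refl b).trans γ.symm) =
      Path.Homotopic.Quotient.refl a
    rw [refl_trans, trans_symm]
  map_mul' p q := by
    change γ.trans ((Path.Homotopic.Quotient.trans q p).trans γ.symm) =
      (γ.trans (Path.Homotopic.Quotient.trans q γ.symm)).trans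
        (γ.trans (Path.Homotopic.Quotient.trans p γ.symm))
    rw [trans_assoc, trans_assoc γ, trans_assoc q γ.symm, ← trans_assoc γ.symm γ, symm_trans,
      refl_trans]

theorem map_conjHom (f : C(X, Y)) {a b : X} (γ : Path.Homotopic.Quotient a b)
    (p : FundamentalGroup X b) :
    FundamentalGroup.map f a (conjHom γ p) =
      conjHom (γ.map f) (FundamentalGroup.map f b p) := by
  change Path.Homotopic.Quotient.map (γ.trans (Path.Homotopic.Quotient.trans p γ.symm)) f = _
  rw [map_trans_class, map_trans_class, map_symm_class]
  rfl

open Path.Homotopic.Quotient in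
theorem conjHom_symm_conjHom {a b : X} (γ : Path.Homotopic.Quotient a b)
    (p : FundamentalGroup X b) : conjHom γ.symm (conjHom γ p) = p := by
  obtain ⟨g, rfl⟩ := mk_surjective γ
  change (mk g).symm.trans (((mk g).trans (Path.Homotopic.Quotient.trans p (mk g).symm)).trans
    (mk g).symm.symm) = p
  have : (mk g).symm.symm = mk g := by rw [← mk_symm, ← mk_symm, Path.symm_symm]
  rw [this, trans_assoc, trans_assoc, symm_trans, trans_refl, ← trans_assoc, symm_trans,
    refl_trans]

open Path.Homotopic.Quotient in
theorem conjHom_refl {a : X} (p : FundamentalGroup X a) :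
    conjHom (Path.Homotopic.Quotient.refl a) p = p := by
  change (Path.Homotopic.Quotient.refl a).trans
    (Path.Homotopic.Quotient.trans p (Path.Homotopic.Quotient.refl a).symm) = p
  have : (Path.Homotopic.Quotient.refl a).symm = Path.Homotopic.Quotient.refl a := by
    rw [← mk_refl, ← mk_symm, Path.refl_symm]
  rw [this, trans_refl, refl_trans]

end BasePoint

theorem FreeInvolution.conjHom_mem_range_iff {X : Type*} [TopologicalSpace X]
    (τ : FreeInvolution X) {a b : X} (γ : Path.Homotopic.Quotient a b)
    (ℓ : FundamentalGroup τ.Orbit (τ.proj b)) :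
    conjHom (γ.map τ.proj) ℓ ∈ (τ.projHom a).range ↔ ℓ ∈ (τ.projHom b).range := by
  constructor
  · rintro ⟨p, hp⟩
    refine ⟨conjHom γ.symm p, ?_⟩
    have h := map_conjHom τ.proj γ.symm p
    rw [map_symm_class] at h
    refine h.trans ?_
    refine (congrArg (conjHom (γ.map τ.proj).symm) hp).trans (conjHom_symm_conjHom _ ℓ)
  · rintro ⟨p, rfl⟩
    exact ⟨conjHom γ p, map_conjHom τ.proj γ p⟩

end GraphBU

/-! ### Equivariant maps and the criterion -/

namespace GraphBU

open scoped unitInterval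
open Set

section Criterion

variable {Γ G : Type*} [TopologicalSpace Γ] [TopologicalSpace G]

theorem mapOfEq_rfl (f : C(Γ, G)) (x₀ : Γ) :
    FundamentalGroup.mapOfEq f (rfl : f x₀ = f x₀) = FundamentalGroup.map f x₀ := by
  ext p
  rw [FundamentalGroup.mapOfEq_apply, Path.Homotopic.Quotient.cast_rfl_rfl]
  rfl

/-- Both homomorphisms come from `F = (f, f ∘ τ)`, transported to the base point `(f x₀, g₁)` along
the path given by the slide. Its first coordinate is null-homotopic, so the transport is invisible
to `fstHom`. -/
theorem exists_homs_of_forall_ne [T2Space Γ] [T2Space G] (τ : FreeInvolution Γ) (x₀ : Γ)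
    (f : C(Γ, G)) (hf : ∀ x, f x ≠ f (τ.toMap x)) {g₁ : G} (h : f x₀ ≠ g₁)
    (hs : Slides (f x₀) g₁ (f (τ.toMap x₀))) :
    ∃ (φ : FundamentalGroup Γ x₀ →* PureBraidGroup (⟨(f x₀, g₁), h⟩ : Conf₂ G))
      (ψ : FundamentalGroup τ.Orbit (τ.proj x₀) →* BraidGroup (⟨(f x₀, g₁), h⟩ : Conf₂ G)),
      (fstHom _).comp φ = FundamentalGroup.map f x₀ ∧
      ((swap G).projHom _).comp φ = ψ.comp (τ.projHom x₀) ∧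
      ((swap G).classifyingHom _).comp ψ = τ.classifyingHom x₀ := by
  let F : C(Γ, Conf₂ G) := ⟨fun x => ⟨(f x, f (τ.toMap x)), hf x⟩, by fun_prop⟩
  have hF : ∀ x, F (τ.toMap x) = (swap G).toMap (F x) := fun x =>
    Subtype.ext (Prod.ext rfl (congrArg f (τ.involutive x)))
  obtain ⟨γ, hγ⟩ := hs.joined h (hf x₀)
  let g : Path.Homotopic.Quotient (⟨(f x₀, g₁), h⟩ : Conf₂ G) (F x₀) := .mk γ
  have hg : g.map (fstProj G) = Path.Homotopic.Quotient.refl (f x₀) :=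
    Path.Homotopic.Quotient.eq.mpr hγ
  refine ⟨(conjHom g).comp (FundamentalGroup.map F x₀),
    (conjHom (g.map (swap G).proj)).comp
      (FundamentalGroup.map (FreeInvolution.orbitMap F hF) (τ.proj x₀)), ?_, ?_, ?_⟩
  · ext p
    refine (map_conjHom (fstProj G) g _).trans ?_
    rw [hg]
    refine (conjHom_refl _).trans ?_
    obtain ⟨p, rfl⟩ := Path.Homotopic.Quotient.mk_surjective p
    rfl
  · ext p
    refine (map_conjHom (swap G).proj g _).trans ?_
    exact congrArg (conjHom (g.map (swap G).proj))
      (FreeInvolution.map_orbitMap_projHom hF x₀ p).symm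
  · rw [FreeInvolution.classifyingHom_comp_eq_iff]
    intro ℓ
    refine ((swap G).conjHom_mem_range_iff g _).trans ?_
    exact FreeInvolution.map_orbitMap_mem_range_iff hF ℓ

/-- The square `hφ` is the lifting criterion for `k ∘ τ.proj` with respect to the double covering of
`UConf₂ G`. Equivariance of the lift comes from `hψ`. -/
theorem exists_equivariant_of_homs [T2Space Γ] [T2Space G] [PathConnectedSpace Γ]
    [LocallyPathConnectedSpace Γ] (τ : FreeInvolution Γ) {x₀ : Γ} {c₀ : Conf₂ G}
    {φ : FundamentalGroup Γ x₀ →* PureBraidGroup c₀}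
    {ψ : FundamentalGroup τ.Orbit (τ.proj x₀) →* BraidGroup c₀}
    (hφ : ((swap G).projHom c₀).comp φ = ψ.comp (τ.projHom x₀))
    (hψ : ((swap G).classifyingHom c₀).comp ψ = τ.classifyingHom x₀)
    (k : C(τ.Orbit, UConf₂ G)) (hk : k (τ.proj x₀) = (swap G).proj c₀)
    (hkψ : FundamentalGroup.mapOfEq k hk = ψ) :
    ∃ (F : C(Γ, Conf₂ G)) (h : F x₀ = c₀), FundamentalGroup.mapOfEq F h = φ ∧
      ∀ x, F (τ.toMap x) = (swap G).toMap (F x) := by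
  let cov := (swap G).isCoveringMap_proj
  rw [FreeInvolution.classifyingHom_comp_eq_iff] at hψ
  obtain ⟨F, ⟨hF₀, hF⟩, -⟩ := cov.existsUnique_continuousMap_lifts_of_range_le
    (f := k.comp τ.proj) (a₀ := x₀) (e₀ := c₀) hk.symm (by
      rintro _ ⟨p, rfl⟩
      refine ⟨φ p, ?_⟩
      have h1 := DFunLike.congr_fun hφ p
      rw [← hkψ] at h1
      obtain ⟨p, rfl⟩ := Path.Homotopic.Quotient.mk_surjective p
      obtain ⟨q, hq⟩ := Path.Homotopic.Quotient.mk_surjective (φ (.mk p))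
      simp only [MonoidHom.comp_apply, FundamentalGroup.mapOfEq_apply] at h1 ⊢
      rw [show FundamentalGroup.map (k.comp τ.proj) x₀ (.mk p) =
        Path.Homotopic.Quotient.map (τ.projHom x₀ (.mk p)) k from rfl]
      rw [show Path.Homotopic.Quotient.map (φ (.mk p)) ⟨(swap G).proj, cov.continuous⟩ =
        (swap G).projHom c₀ (φ (.mk p)) from rfl, h1]
      rw [Path.Homotopic.Quotient.cast_cast, Path.Homotopic.Quotient.cast_rfl_rfl])
  have hF' : ∀ x, (swap G).proj (F x) = k (τ.proj x) := congrFun hF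
  subst hF₀
  have hkF : k.comp τ.proj = (swap G).proj.comp F := ContinuousMap.ext fun x => (hF' x).symm
  have hmap : ∀ {a b : Γ} (L : Path a b),
      (L.map τ.proj.continuous).map k.continuous =
        ((L.map F.continuous).map (swap G).proj.continuous).cast (hF' a).symm (hF' b).symm := by
    intro a b L
    exact Path.ext (funext fun t => (hF' (L t)).symm)
  refine ⟨F, rfl, ?_, fun x => ?_⟩
  · rw [mapOfEq_rfl]
    ext p
    apply (swap G).projHom_injective
    have h1 := DFunLike.congr_fun hφ p
    refine Eq.trans ?_ h1.symm
    rw [← hkψ, MonoidHom.comp_apply, FundamentalGroup.mapOfEq_apply]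
    obtain ⟨p, rfl⟩ := Path.Homotopic.Quotient.mk_surjective p
    exact congrArg Path.Homotopic.Quotient.mk (Path.ext (funext fun t => hF' (p t)))
  · have h1 : (swap G).proj (F (τ.toMap x)) = (swap G).proj (F x) := by
      rw [hF', hF', τ.proj_toMap]
    rcases (swap G).proj_eq_iff.mp h1 with h2 | h2
    -- If `F ∘ τ` and `F` agree at one point, they agree everywhere as lifts of the same map. A path
    -- from `x₀` to `τ x₀` then maps to a loop in `Conf₂ G`, although its projection is not in the
    -- range of `τ.projHom`; this contradicts `hψ`.
    · exfalso
      have h3 : (F.comp τ.toMap : Γ → Conf₂ G) = F :=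
        cov.eq_of_comp_eq (F.comp τ.toMap).continuous F.continuous
          (funext fun y => by
            change (swap G).proj (F (τ.toMap y)) = (swap G).proj (F y)
            rw [hF', hF', τ.proj_toMap]) x h2
      have h4 : F (τ.toMap x₀) = F x₀ := congrFun h3 x₀
      obtain ⟨L⟩ := PathConnectedSpace.joined x₀ (τ.toMap x₀)
      refine τ.mk_map_cast_notMem_range L (τ.free x₀) (τ.proj_toMap x₀).symm
        ((hψ _).mp ⟨.mk ((L.map F.continuous).cast rfl h4.symm), ?_⟩)
      rw [← hkψ, FundamentalGroup.mapOfEq_apply]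
      exact congrArg Path.Homotopic.Quotient.mk (Path.ext (funext fun t => hF' (L t)))
    · exact h2

theorem exists_equivariant_of_graph_homs [FiniteConnectedGraph Γ] [T2Space G]
    (τ : FreeInvolution Γ) {x₀ : Γ} {c₀ : Conf₂ G}
    {φ : FundamentalGroup Γ x₀ →* PureBraidGroup c₀}
    {ψ : FundamentalGroup τ.Orbit (τ.proj x₀) →* BraidGroup c₀}
    (hφ : ((swap G).projHom c₀).comp φ = ψ.comp (τ.projHom x₀))
    (hψ : ((swap G).classifyingHom c₀).comp ψ = τ.classifyingHom x₀) :
    ∃ (F : C(Γ, Conf₂ G)) (h : F x₀ = c₀), FundamentalGroup.mapOfEq F h = φ ∧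
      ∀ x, F (τ.toMap x) = (swap G).toMap (F x) := by
  have : Nontrivial Γ := ⟨⟨_, _, τ.free x₀⟩⟩
  obtain ⟨n, e, he⟩ := FiniteConnectedGraph.exists_isEdgeSystem Γ
  have := he.pathConnectedSpace
  have := he.locallyPathConnectedSpace
  -- The added points make the vertex set invariant under the involution and let it contain `x₀`.
  obtain ⟨m, e', he', hV⟩ := he.exists_subdivision
    (S := τ.toMap '' vertexSet e ∪ {x₀, τ.toMap x₀})
    (((IsEdgeSystem.finite_vertexSet e).image _).union (by simp))
  obtain ⟨l, b, hb, hbV⟩ := he'.exists_orbit_isEdgeSystem τ (by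
    rw [hV]
    rintro x (hx | ⟨y, hy, rfl⟩ | rfl | rfl)
    · exact Or.inr (Or.inl ⟨x, hx, rfl⟩)
    · rw [τ.involutive]
      exact Or.inl hy
    · exact Or.inr (Or.inr (Or.inr rfl))
    · rw [τ.involutive]
      exact Or.inr (Or.inr (Or.inl rfl)))
  have hx₀ : τ.proj x₀ ∈ vertexSet b :=
    hbV ⟨x₀, by rw [hV]; exact Or.inr (Or.inr (Or.inl rfl)), rfl⟩
  obtain ⟨k, hk, hkψ⟩ := hb.exists_map_of_hom hx₀ ψ
  exact exists_equivariant_of_homs τ hφ hψ k hk hkψ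

end Criterion

end GraphBU

open GraphBU in
theorem theorem3p1
    {Γ G : Type*} [TopologicalSpace Γ] [TopologicalSpace G]
    [FiniteConnectedGraph Γ] [FiniteConnectedGraph G]
    (hG : ¬ Nonempty (G ≃ₜ unitInterval))
    (τ : FreeInvolution Γ)
    (x₀ : Γ) (g₀ g₁ : G) (h : g₀ ≠ g₁) :
    let c₀ : Conf₂ G := ⟨(g₀, g₁), h⟩
    IsShortExact (τ.projHom x₀) (τ.classifyingHom x₀) ∧
    IsShortExact ((swap G).projHom c₀) ((swap G).classifyingHom c₀) ∧
    ∀ α : BasedHomotopyClass Γ G x₀ g₀,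
      ¬ BorsukUlam τ α ↔
        ∃ (φ : FundamentalGroup Γ x₀ →* PureBraidGroup c₀)
          (ψ : FundamentalGroup τ.Orbit (τ.proj x₀) →* BraidGroup c₀),
          (fstHom c₀).comp φ = α.induced ∧
          ((swap G).projHom c₀).comp φ = ψ.comp (τ.projHom x₀) ∧
          ((swap G).classifyingHom c₀).comp ψ = τ.classifyingHom x₀ := by
  intro c₀
  have : Nontrivial Γ := ⟨⟨_, _, τ.free x₀⟩⟩
  have : Nontrivial G := ⟨⟨_, _, h⟩⟩
  obtain ⟨n, e, he⟩ := FiniteConnectedGraph.exists_isEdgeSystem Γ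
  obtain ⟨m, b, hb⟩ := FiniteConnectedGraph.exists_isEdgeSystem G
  have := he.pathConnectedSpace
  have := hb.pathConnectedSpace_conf hG
  refine ⟨τ.isShortExact x₀, (swap G).isShortExact c₀, fun α => ⟨fun hα => ?_, ?_⟩⟩
  · simp only [BorsukUlam, not_forall, not_exists] at hα
    obtain ⟨⟨f, hf₀⟩, rfl, hf⟩ := hα
    subst hf₀
    obtain ⟨φ, ψ, h1, h2, h3⟩ := exists_homs_of_forall_ne τ x₀ f hf h
      (hb.isSlidable hG (f x₀) g₁ _ h.symm (Ne.symm (hf x₀)))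
    exact ⟨φ, ψ, h1.trans (mapOfEq_rfl f x₀).symm, h2, h3⟩
  · rintro ⟨φ, ψ, h1, h2, h3⟩ hα
    obtain ⟨F, hF₀, hFφ, hF⟩ := exists_equivariant_of_graph_homs τ h2 h3
    have hf₀ : (fstProj G).comp F x₀ = g₀ := congrArg (fstProj G) hF₀
    -- The first coordinate of `F` induces `fstHom ∘ φ = α_#`, so it represents `α`.
    have hα' : BasedMap.toClass ⟨(fstProj G).comp F, hf₀⟩ = α := by
      obtain ⟨⟨f, hf⟩, rfl⟩ := Quotient.exists_rep α
      obtain ⟨m', e', he', hV⟩ := he.exists_subdivision (Set.finite_singleton x₀)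
      refine Quotient.sound (he'.homotopicRel_of_mapOfEq_eq (by rw [hV]; exact Or.inr rfl)
        _ _ hf₀ hf (Eq.trans ?_ h1))
      rw [← hFφ]
      ext p
      obtain ⟨p, rfl⟩ := Path.Homotopic.Quotient.mk_surjective p
      rw [MonoidHom.comp_apply, FundamentalGroup.mapOfEq_apply, FundamentalGroup.mapOfEq_apply]
      rfl
    obtain ⟨x, hx⟩ := hα ⟨(fstProj G).comp F, hf₀⟩ hα'
    refine (F x).2 (hx.trans ?_)
    change (F (τ.toMap x)).1.1 = _
    rw [hF]
    rfl
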